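/- Let $(Y,d)$ be a discrete proper metric space (every closed ball is finite) and let $\Gamma$ be a group acting on $Y$ freely and by isometries, with finite quotient $\Gamma\backslash Y$. Let $\mathcal F$ be a hermitian sheaf of $r$-dimensional complex vector spaces on $Y$, i.e. a family of $r$-dimensional hermitian spaces $\mathcal F(y)$, $y\in Y$, to which the action of $\Gamma$ lifts by unitary maps $\mathcal F(y)\to\mathcal F(\gamma y)$. Let $\Gamma(\mathcal F)$ and $\Gamma_c(\mathcal F)$ be the spaces of all sections and of finitely supported sections. Let $D:\Gamma_c(\mathcal F)\to\Gamma(\mathcal F)$ be linear, commute with the action of $\Gamma$, and have finite propagation speed: for some $R>0$, $\operatorname{supp}D\varphi\subset\{y: d(y,\operatorname{supp}\varphi)<R\}$ for all $\varphi\in\Gamma_c(\mathcal F)$. Then $D$ maps $\Gamma_c(\mathcal F)$ to itself and extends continuously to a bounded operator on the Hilbert space $L^2(\mathcal F)$ of square integrable sections, again denoted $D$. For a subgroup $\Gamma'\subset\Gamma$ of finite index let $\Gamma(\mathcal F_{\Gamma'})=\Gamma(\mathcal F)^{\Gamma'}$ be the (finite dimensional) space of sections of the quotient sheaf, let $S:\Gamma_c(\mathcal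 F)\to\Gamma(\mathcal F_{\Gamma'})$, $S\varphi(y)=\sum_{\gamma\in\Gamma'}\gamma^{-1}\varphi(\gamma y)$, and let the pushdown $D_{\Gamma'}$ be the unique linear operator on $\Gamma(\mathcal F_{\Gamma'})$ with $D_{\Gamma'}S=SD$. Let $\operatorname{tr}_\Gamma=\tau\otimes\operatorname{tr}$ be the trace on the algebra $B(L^2(\mathcal F))^\Gamma\cong VN(\Gamma)\otimes B(L^2(\mathcal F|_{S_0}))$ of bounded $\Gamma$-invariant operators, where $S_0$ is a set of representatives of $\Gamma\backslash Y$, $VN(\Gamma)$ is the group von Neumann algebra and $\tau(\sum_\gamma c_\gamma L_\gamma)=c_e$; that is, $\operatorname{tr}_\Gamma T$ is the trace of the compression of $T$ to $L^2(\mathcal F|_{S_0})$. For $\lambda\in\mathbb C$ such that the spectrum of $D+\lambda$ lies in the open right half-plane put $$\det{}_\Gamma(D+\lambda)=\exp\Big(-\tfrac{d}{ds}\Big|_{s=0}\operatorname{tr}_\Gamma\big((D+\lambda)^{-s}\big)\Big),$$ where $(D+\lambda)^{-s}$ is defined by holomorphic functional calculus with the principal branch of the logarithm. Let $(\Gamma_j)_{j\ge1}$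 be a tower in $\Gamma$: a sequence $\Gamma=\Gamma_1\supset\Gamma_2\supset\cdots$ of normal subgroups of finite index with $\bigcap_j\Gamma_j=\{1\}$. Then there is a real number $C$ such that the following hold on the half-plane $H=\{\lambda\in\mathbb C:\operatorname{Re}\lambda>C\}$. 1. For every $\lambda\in H$ the spectrum of $D+\lambda$ lies in the open right half-plane and $s\mapsto\operatorname{tr}_\Gamma((D+\lambda)^{-s})$ is differentiable at $0$, so $\det_\Gamma(D+\lambda)$ is defined. 2. For every $j$ the function $\lambda\mapsto\det(D_{\Gamma_j}+\lambda)$ has no zero in $H$, and it has a standard root $\det(D_{\Gamma_j}+\lambda)^{1/[\Gamma:\Gamma_j]}$ on $H$, i.e. a holomorphic function $f_j$ on $H$ with $f_j(\lambda)^{[\Gamma:\Gamma_j]}=\det(D_{\Gamma_j}+\lambda)$ and $f_j(\lambda)/|f_j(\lambda)|\to1$ as $\lambda\to+\infty$ along the real axis. 3. For any choice of these standard roots, $$\det(D_{\Gamma_j}+\lambda)^{1/[\Gamma:\Gamma_j]}\longrightarrow\det{}_\Gamma(D+\lambda)\qquad(j\to\infty)$$ locally uniformly for $\lambda\in H$.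 -/

import Mathlib

open Filter Topology

namespace DiscreteSheaf

universe u v w

/-! ## Sections of a sheaf on a discrete space, and operators on them

A sheaf of complex vector spaces on a discrete space `Y` is a family of stalks `F y`; its global
sections are the dependent functions `∀ y, F y`. -/

section Sections

variable {Y : Type v} (F : Y → Type w) [∀ y, NormedAddCommGroup (F y)]
  [∀ y, InnerProductSpace ℂ (F y)]

/-- The support of a section. -/
def supp {F : Y → Type w} [∀ y, NormedAddCommGroup (F y)] (φ : ∀ y, F y) : Set Y :=
  {y | φ y ≠ 0}

/-- The space of compactly supported sections. In a discrete space every set is closed and the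
compact sets are the finite ones, so these are the sections of finite support. -/
def CompactSections : Submodule ℂ (∀ y, F y) where
  carrier := {φ | (supp φ).Finite}
  zero_mem' := by simp [supp]
  add_mem' := by
    intro φ ψ hφ hψ
    refine (hφ.union hψ).subset fun y hy => ?_
    by_contra h
    simp only [supp, Set.mem_union, Set.mem_ofPred_eq, not_or, not_not] at h
    exact hy (by simp [h.1, h.2])
  smul_mem' := by
    intro c φ hφ
    refine hφ.subset fun y hy h => hy ?_
    simp [h]

/-- The Hilbert space of square integrable sections. -/
abbrev L2 : Type (max v w) := lp F 2

instance instCompleteSpaceL2 [∀ y, FiniteDimensional ℂ (F y)] : CompleteSpace (L2 F) :=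
  haveI : ∀ y, CompleteSpace (F y) := fun y => FiniteDimensional.complete ℂ (F y)
  inferInstance

variable {F}

/-- Compactly supported sections are square integrable. -/
def toL2 : CompactSections F →ₗ[ℂ] L2 F where
  toFun φ := ⟨φ.1, (memℓp_zero φ.2).of_exponent_ge (zero_le)⟩
  map_add' _ _ := rfl
  map_smul' _ _ := rfl

/-- `D` has propagation speed at most `R`: the support of `D φ` is contained in the open
`R`-neighbourhood of the support of `φ`. -/
def HasPropagationSpeedLE [PseudoMetricSpace Y] (D : CompactSections F →ₗ[ℂ] (∀ y, F y))
    (R : ℝ) : Prop :=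
  ∀ φ : CompactSections F, supp (D φ) ⊆ Metric.thickening R (supp φ.1)

/-- `D` has finite propagation speed. -/
def HasFinitePropagationSpeed [PseudoMetricSpace Y]
    (D : CompactSections F →ₗ[ℂ] (∀ y, F y)) : Prop :=
  ∃ R : ℝ, 0 < R ∧ HasPropagationSpeedLE D R

theorem finite_ball [MetricSpace Y] [DiscreteTopology Y] [ProperSpace Y] (y : Y) (R : ℝ) :
    (Metric.ball y R).Finite :=
  ((isCompact_closedBall y R).finite_of_discrete).subset Metric.ball_subset_closedBall

/-- An operator of finite propagation speed preserves compactly supported sections. -/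
theorem map_mem_compactSections [MetricSpace Y] [DiscreteTopology Y] [ProperSpace Y]
    {D : CompactSections F →ₗ[ℂ] (∀ y, F y)} (hD : HasFinitePropagationSpeed D)
    (φ : CompactSections F) : D φ ∈ CompactSections F := by
  obtain ⟨R, -, hR⟩ := hD
  refine Set.Finite.subset ?_ (hR φ)
  rw [Metric.thickening_eq_biUnion_ball]
  exact Set.Finite.biUnion φ.2 fun y _ => finite_ball y R

/-- An operator of finite propagation speed as an endomorphism of the space of compactly supported
sections. -/
def compactEnd [MetricSpace Y] [DiscreteTopology Y] [ProperSpace Y]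
    (D : CompactSections F →ₗ[ℂ] (∀ y, F y)) (hD : HasFinitePropagationSpeed D) :
    CompactSections F →ₗ[ℂ] CompactSections F :=
  D.codRestrict (CompactSections F) (map_mem_compactSections hD)

/-- The continuous extension of an operator of finite propagation speed to the square integrable
sections. -/
noncomputable def l2Extension [MetricSpace Y] [DiscreteTopology Y] [ProperSpace Y]
    [∀ y, FiniteDimensional ℂ (F y)]
    (D : CompactSections F →ₗ[ℂ] (∀ y, F y)) (hD : HasFinitePropagationSpeed D) :
    L2 F →L[ℂ] L2 F :=
  (toL2 ∘ₗ compactEnd D hD).extendOfNorm toL2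

end Sections

/-! ## Group actions on a hermitian sheaf -/

/-- A lift of the action of `Γ` on `Y` to the hermitian sheaf `F`, unitary on stalks:
`g` maps the stalk at `y` onto the stalk at `g • y`. The two laws are those of a group action,
stated in the total space `Σ y, F y`. -/
structure UnitaryLift (Γ : Type u) [Group Γ] {Y : Type v} [MulAction Γ Y] (F : Y → Type w)
    [∀ y, NormedAddCommGroup (F y)] [∀ y, InnerProductSpace ℂ (F y)] where
  map (g : Γ) (y : Y) : F y ≃ₗᵢ[ℂ] F (g • y)
  map_one (y : Y) (v : F y) : (⟨(1 : Γ) • y, map 1 y v⟩ : Σ y, F y) = ⟨y, v⟩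
  map_mul (g h : Γ) (y : Y) (v : F y) :
    (⟨(g * h) • y, map (g * h) y v⟩ : Σ y, F y) = ⟨g • h • y, map g (h • y) (map h y v)⟩

section Action

variable {Γ : Type u} [Group Γ] {Y : Type v} [MulAction Γ Y] {F : Y → Type w}
  [∀ y, NormedAddCommGroup (F y)] [∀ y, InnerProductSpace ℂ (F y)] (A : UnitaryLift Γ F)

/-- The action on sections: `(g φ)(x) = g (φ (g⁻¹ x))`, that is `(g φ)(g y) = g (φ y)`
(see `act_smul`). -/
def act (g : Γ) : (∀ y, F y) →ₗ[ℂ] (∀ y, F y) where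
  toFun φ x := (smul_inv_smul g x) ▸ A.map g (g⁻¹ • x) (φ (g⁻¹ • x))
  map_add' φ ψ := by
    funext x
    have : ∀ (z : Y) (h : z = x) (a b : F z), (h ▸ (a + b) : F x) = (h ▸ a) + (h ▸ b) := by
      rintro z rfl a b; rfl
    simp only [Pi.add_apply, _root_.map_add]
    exact this _ _ _ _
  map_smul' c φ := by
    funext x
    have : ∀ (z : Y) (h : z = x) (a : F z), (h ▸ (c • a) : F x) = c • (h ▸ a : F x) := by
      rintro z rfl a; rfl
    simp only [Pi.smul_apply, _root_.map_smul, RingHom.id_apply]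
    exact this _ _ _

theorem act_smul (g : Γ) (φ : ∀ y, F y) (y : Y) : act A g φ (g • y) = A.map g y (φ y) := by
  have : ∀ (z : Y) (h : z = y) (h' : g • z = g • y),
      (h' ▸ A.map g z (φ z) : F (g • y)) = A.map g y (φ y) := by
    rintro z rfl _; rfl
  exact this _ (inv_smul_smul g y) _

theorem act_one (φ : ∀ y, F y) : act A 1 φ = φ := by
  funext y
  have h1 := A.map_one y (φ y)
  rw [← act_smul] at h1
  have h2 : (⟨(1 : Γ) • y, act A 1 φ ((1 : Γ) • y)⟩ : Σ y, F y) = ⟨y, act A 1 φ y⟩ := by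
    rw [one_smul]
  rw [h2] at h1
  simpa using h1

theorem act_mul (g h : Γ) (φ : ∀ y, F y) : act A (g * h) φ = act A g (act A h φ) := by
  funext x
  obtain ⟨y, rfl⟩ : ∃ y, x = g • h • y := ⟨h⁻¹ • g⁻¹ • x, by simp⟩
  have h1 := A.map_mul g h y (φ y)
  rw [← act_smul, ← act_smul, ← act_smul] at h1
  have h2 : (⟨(g * h) • y, act A (g * h) φ ((g * h) • y)⟩ : Σ y, F y)
      = ⟨g • h • y, act A (g * h) φ (g • h • y)⟩ := by
    rw [mul_smul]
  rw [h2] at h1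
  simpa using h1

theorem act_eq_zero_iff (g : Γ) (φ : ∀ y, F y) (y : Y) :
    act A g⁻¹ φ y = 0 ↔ φ (g • y) = 0 := by
  rw [← LinearIsometryEquiv.map_eq_zero_iff (A.map g⁻¹ (g • y)), ← act_smul]
  have : ∀ (z : Y) (_ : z = y), act A g⁻¹ φ z = 0 ↔ act A g⁻¹ φ y = 0 := by
    rintro z rfl; rfl
  exact (this _ (inv_smul_smul g y)).symm

theorem act_mem (g : Γ) (φ : CompactSections F) : act A g φ.1 ∈ CompactSections F := by
  refine (φ.2.image (g • ·)).subset fun x hx => ⟨g⁻¹ • x, ?_, by simp⟩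
  intro h
  have := (act_eq_zero_iff A g⁻¹ φ.1 x).2 h
  rw [inv_inv] at this
  exact hx this

/-- The action on compactly supported sections. -/
def actc (g : Γ) : CompactSections F →ₗ[ℂ] CompactSections F :=
  ((act A g) ∘ₗ (CompactSections F).subtype).codRestrict (CompactSections F) (act_mem A g)

/-- `D` is `Γ`-invariant: it commutes with the action of `Γ`. -/
def IsGammaInvariant (D : CompactSections F →ₗ[ℂ] (∀ y, F y)) : Prop :=
  ∀ (g : Γ) (φ : CompactSections F), D (actc A g φ) = act A g (D φ)

/-! ## The quotient sheaf, the summation map and the pushdown -/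

/-- The space of sections of the quotient sheaf `H \ F` on `H \ Y`: the `H`-invariant sections
of `F`. -/
def InvariantSections (H : Subgroup Γ) : Submodule ℂ (∀ y, F y) where
  carrier := {φ | ∀ h ∈ H, act A h φ = φ}
  zero_mem' := by simp
  add_mem' := by
    intro φ ψ hφ hψ h hh
    simp [hφ h hh, hψ h hh]
  smul_mem' := by
    intro c φ hφ h hh
    simp [hφ h hh]

theorem finite_act_ne_zero [IsCancelSMul Γ Y] (H : Subgroup Γ) (φ : CompactSections F) (y : Y) :
    (Function.support fun g : H => act A (g : Γ)⁻¹ φ.1 y).Finite := by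
  have hinj : Function.Injective fun g : H => (g : Γ) • y := fun a b hab =>
    Subtype.ext (IsCancelSMul.right_cancel _ _ _ hab)
  refine (φ.2.preimage hinj.injOn).subset fun g hg => ?_
  exact fun h => hg ((act_eq_zero_iff A (g : Γ) φ.1 y).2 h)

theorem summation_mem [IsCancelSMul Γ Y] (H : Subgroup Γ) (φ : CompactSections F) :
    (fun y => ∑ᶠ g : H, act A (g : Γ)⁻¹ φ.1 y) ∈ InvariantSections A H := by
  intro h hh
  funext x
  obtain ⟨y, rfl⟩ : ∃ y, x = h • y := ⟨h⁻¹ • x, by simp⟩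
  rw [act_smul]
  rw [map_finsum (A.map h y) (finite_act_ne_zero A H φ y)]
  rw [← finsum_comp_equiv (Equiv.mulRight (⟨h, hh⟩ : H)⁻¹)
    (f := fun g : H => act A (g : Γ)⁻¹ φ.1 (h • y))]
  refine finsum_congr fun g => ?_
  rw [← act_smul, ← act_mul]
  simp

/-- The summation map `S`, `(S φ)(y) = ∑_{g ∈ H} g⁻¹ (φ (g y))`. -/
noncomputable def summation [IsCancelSMul Γ Y] (H : Subgroup Γ) :
    CompactSections F →ₗ[ℂ] InvariantSections A H where
  toFun φ := ⟨fun y => ∑ᶠ g : H, act A (g : Γ)⁻¹ φ.1 y, summation_mem A H φ⟩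
  map_add' φ ψ := by
    ext y
    simp only [Submodule.coe_add, _root_.map_add, Pi.add_apply]
    exact finsum_add_distrib (finite_act_ne_zero A H φ y) (finite_act_ne_zero A H ψ y)
  map_smul' c φ := by
    ext y
    simp only [Submodule.coe_smul, _root_.map_smul, Pi.smul_apply, RingHom.id_apply]
    exact (smul_finsum' c (finite_act_ne_zero A H φ y)).symm

theorem act_inv_congr (g : Γ) {φ ψ : ∀ y, F y} {y : Y} (h : φ (g • y) = ψ (g • y)) :
    act A g⁻¹ φ y = act A g⁻¹ ψ y := by
  have := (act_eq_zero_iff A g (φ - ψ) y).2 (by simp [h])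
  rw [_root_.map_sub] at this
  exact sub_eq_zero.1 this

theorem summation_apply [IsCancelSMul Γ Y] (H : Subgroup Γ) (φ : CompactSections F) (y : Y) :
    (summation A H φ).1 y = ∑ᶠ g : H, act A (g : Γ)⁻¹ φ.1 y := rfl

theorem summation_surjective [IsCancelSMul Γ Y] (H : Subgroup Γ)
    [Finite (MulAction.orbitRel.Quotient H Y)] : Function.Surjective (summation A H) := by
  classical
  intro ψ
  let q : Y → MulAction.orbitRel.Quotient H Y := Quotient.mk''
  let φ : ∀ y, F y := fun y => if (q y).out = y then ψ.1 y else 0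
  have hφ : φ ∈ CompactSections F := by
    refine (Set.finite_range fun o : MulAction.orbitRel.Quotient H Y => o.out).subset ?_
    intro y hy
    refine ⟨q y, ?_⟩
    by_contra h
    exact hy (if_neg h)
  refine ⟨⟨φ, hφ⟩, ?_⟩
  ext y
  rw [summation_apply]
  have hr : (q y).out ∈ MulAction.orbit H y :=
    MulAction.orbitRel_apply.1 (Quotient.mk_out (s := MulAction.orbitRel H Y) y)
  obtain ⟨g, hg⟩ := hr
  have hg' : (g : Γ) • y = (q y).out := hg
  have hq : ∀ a : H, q ((a : Γ) • y) = q y := fun a =>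
    Quotient.sound (s := MulAction.orbitRel H Y) (MulAction.orbitRel_apply.2 ⟨a, rfl⟩)
  rw [finsum_eq_single _ g]
  · have h1 : φ ((g : Γ) • y) = ψ.1 ((g : Γ) • y) := by
      refine if_pos ?_
      rw [hq, hg']
    rw [act_inv_congr A (g : Γ) h1, ψ.2 _ (inv_mem g.2)]
  · intro a ha
    refine (act_eq_zero_iff A (a : Γ) φ y).2 (if_neg ?_)
    rw [hq, ← hg']
    intro h
    exact ha (Subtype.ext (IsCancelSMul.right_cancel _ _ _ h)).symm

/-- The operator `S ∘ D` vanishes on the kernel of `S`. -/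
theorem ker_summation_le [IsCancelSMul Γ Y] [MetricSpace Y] [DiscreteTopology Y] [ProperSpace Y]
    {D : CompactSections F →ₗ[ℂ] (∀ y, F y)} (hD : IsGammaInvariant A D)
    (hR : HasFinitePropagationSpeed D) (H : Subgroup Γ) :
    LinearMap.ker (summation A H) ≤ LinearMap.ker (summation A H ∘ₗ compactEnd D hR) := by
  classical
  intro φ hφ
  rw [LinearMap.mem_ker] at hφ ⊢
  obtain ⟨R, hR0, hR'⟩ := id hR
  have hzero : ∀ (χ : CompactSections F) (y : Y), (∀ z ∈ Metric.ball y R, χ.1 z = 0) →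
      D χ y = 0 := by
    intro χ y h
    by_contra hne
    obtain ⟨z, hz, hyz⟩ := Metric.mem_thickening_iff.1 (hR' χ hne)
    exact hz (h z (by rwa [Metric.mem_ball, dist_comm]))
  ext y
  rw [LinearMap.comp_apply, summation_apply]
  have hc : ∀ g : H, act A (g : Γ)⁻¹ (compactEnd D hR φ).1 y = D (actc A (g : Γ)⁻¹ φ) y :=
    fun g => (congrFun (hD (g : Γ)⁻¹ φ) y).symm
  simp_rw [hc]
  let E : Finset H := ((finite_ball y R).biUnion fun z _ => finite_act_ne_zero A H φ z).toFinset
  have hE : ∀ (g : H) (z : Y), z ∈ Metric.ball y R → act A (g : Γ)⁻¹ φ.1 z ≠ 0 → g ∈ E := by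
    intro g z hz h
    simp only [E, Set.Finite.mem_toFinset, Set.mem_iUnion]
    exact ⟨z, hz, h⟩
  rw [finsum_eq_sum_of_support_subset (s := E)]
  · have h1 : ∑ g ∈ E, D (actc A (g : Γ)⁻¹ φ) y = D (∑ g ∈ E, actc A (g : Γ)⁻¹ φ) y := by
      rw [_root_.map_sum, Finset.sum_apply]
    rw [h1]
    refine hzero _ _ fun z hz => ?_
    have h2 := congrFun (congrArg Subtype.val hφ) z
    rw [summation_apply, finsum_eq_sum_of_support_subset (s := E)] at h2
    · rw [Submodule.coe_sum, Finset.sum_apply]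
      exact h2
    · intro g hg
      exact hE g z hz hg
  · intro g hg
    by_contra hgE
    refine hg (hzero _ _ fun z hz => ?_)
    by_contra h
    exact hgE (hE g z hz h)

/-- The pushdown `D_H` of `D`: the operator on the sections of the quotient sheaf that is induced
by `S ∘ D` through the surjection `S`. It is the unique operator with `D_H ∘ S = S ∘ D`
(see `pushdown_comp_summation` and `pushdown_unique`). -/
noncomputable def pushdown [IsCancelSMul Γ Y] [MetricSpace Y] [DiscreteTopology Y] [ProperSpace Y]
    (D : CompactSections F →ₗ[ℂ] (∀ y, F y)) (hD : IsGammaInvariant A D)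
    (hR : HasFinitePropagationSpeed D) (H : Subgroup Γ)
    [Finite (MulAction.orbitRel.Quotient H Y)] : Module.End ℂ (InvariantSections A H) :=
  (Submodule.liftQ (LinearMap.ker (summation A H)) (summation A H ∘ₗ compactEnd D hR)
      (ker_summation_le A hD hR H)) ∘ₗ
    ((summation A H).quotKerEquivOfSurjective (summation_surjective A H)).symm.toLinearMap

theorem pushdown_comp_summation [IsCancelSMul Γ Y] [MetricSpace Y] [DiscreteTopology Y]
    [ProperSpace Y] {D : CompactSections F →ₗ[ℂ] (∀ y, F y)} (hD : IsGammaInvariant A D)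
    (hR : HasFinitePropagationSpeed D) (H : Subgroup Γ)
    [Finite (MulAction.orbitRel.Quotient H Y)] :
    pushdown A D hD hR H ∘ₗ summation A H = summation A H ∘ₗ compactEnd D hR := by
  ext1 φ
  have h : ((summation A H).quotKerEquivOfSurjective (summation_surjective A H)).symm
      (summation A H φ) = Submodule.Quotient.mk φ := by
    rw [LinearEquiv.symm_apply_eq]
    rfl
  simp only [pushdown, LinearMap.comp_apply, LinearEquiv.coe_coe, h]
  rfl

theorem pushdown_unique [IsCancelSMul Γ Y] [MetricSpace Y] [DiscreteTopology Y]
    [ProperSpace Y] {D : CompactSections F →ₗ[ℂ] (∀ y, F y)} (hD : IsGammaInvariant A D)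
    (hR : HasFinitePropagationSpeed D) (H : Subgroup Γ)
    [Finite (MulAction.orbitRel.Quotient H Y)] (P : Module.End ℂ (InvariantSections A H))
    (hP : P ∘ₗ summation A H = summation A H ∘ₗ compactEnd D hR) :
    P = pushdown A D hD hR H := by
  rw [← pushdown_comp_summation A hD hR H] at hP
  ext1 ψ
  obtain ⟨φ, rfl⟩ := summation_surjective A H ψ
  exact LinearMap.congr_fun hP φ

instance instFiniteDimensionalInvariantSections [∀ y, FiniteDimensional ℂ (F y)] (H : Subgroup Γ)
    [Finite (MulAction.orbitRel.Quotient H Y)] :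
    FiniteDimensional ℂ (InvariantSections A H) := by
  let f : InvariantSections A H →ₗ[ℂ] (∀ o : MulAction.orbitRel.Quotient H Y, F o.out) :=
    { toFun := fun φ o => φ.1 o.out
      map_add' := fun _ _ => rfl
      map_smul' := fun _ _ => rfl }
  refine FiniteDimensional.of_injective f ((injective_iff_map_eq_zero f).2 fun φ hφ => ?_)
  ext y
  obtain ⟨g, hg⟩ : (Quotient.mk'' y : MulAction.orbitRel.Quotient H Y).out ∈ MulAction.orbit H y :=
    MulAction.orbitRel_apply.1 (Quotient.mk_out (s := MulAction.orbitRel H Y) y)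
  have hg' : (g : Γ) • y = (Quotient.mk'' y : MulAction.orbitRel.Quotient H Y).out := hg
  have h1 : φ.1 ((g : Γ) • y) = 0 := by
    rw [hg']
    exact congrFun hφ _
  have h2 := (act_eq_zero_iff A (g : Γ) φ.1 y).2 h1
  rwa [φ.2 _ (inv_mem g.2)] at h2

/-! ## Boundedness on square integrable sections -/

theorem denseRange_toL2 : DenseRange (toL2 : CompactSections F →ₗ[ℂ] L2 F) := by
  classical
  intro f
  refine mem_closure_of_tendsto (lp.hasSum_single (by simp) f) (Eventually.of_forall fun s => ?_)
  refine ⟨⟨⇑(∑ y ∈ s, lp.single 2 y (f y)), ?_⟩, ?_⟩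
  · refine s.finite_toSet.subset fun y hy => ?_
    by_contra h
    refine hy ?_
    rw [lp.coeFn_sum, Finset.sum_apply]
    refine Finset.sum_eq_zero fun z hz => ?_
    exact lp.single_apply_ne _ _ _ (by rintro rfl; exact h hz)
  · exact Subtype.ext rfl

theorem norm_act_inv (g : Γ) (φ : ∀ y, F y) (y : Y) : ‖act A g⁻¹ φ y‖ = ‖φ (g • y)‖ := by
  have h : ‖act A g⁻¹ φ (g⁻¹ • g • y)‖ = ‖φ (g • y)‖ := by
    rw [act_smul, LinearIsometryEquiv.norm_map]
  rw [← h, inv_smul_smul]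

theorem local_bound [MetricSpace Y] [DiscreteTopology Y] [ProperSpace Y]
    [∀ y, FiniteDimensional ℂ (F y)]
    {D : CompactSections F →ₗ[ℂ] (∀ y, F y)} {R : ℝ} (hR : HasPropagationSpeedLE D R) (x : Y) :
    ∃ M : ℝ, 0 ≤ M ∧ ∀ φ : CompactSections F,
      ‖D φ x‖ ^ 2 ≤ M * ∑ y ∈ (finite_ball x R).toFinset, ‖φ.1 y‖ ^ 2 := by
  classical
  let δ : ∀ y, F y →ₗ[ℂ] CompactSections F := fun y =>
    (LinearMap.single ℂ F y).codRestrict (CompactSections F) fun v =>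
      (Set.finite_singleton y).subset fun z hz => by
        by_contra h
        exact hz (Pi.single_eq_of_ne h _)
  have hb : ∀ y, ∃ c : ℝ, ∀ v : F y, ‖D (δ y v) x‖ ≤ c * ‖v‖ := fun y => by
    let L : F y →ₗ[ℂ] F x := LinearMap.proj x ∘ₗ D ∘ₗ δ y
    exact ⟨‖LinearMap.toContinuousLinearMap L‖, fun v =>
      (LinearMap.toContinuousLinearMap L).le_opNorm v⟩
  choose c hc using hb
  refine ⟨∑ y ∈ (finite_ball x R).toFinset, c y ^ 2,
    Finset.sum_nonneg fun _ _ => sq_nonneg _, fun φ => ?_⟩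
  have h1 : D φ x = ∑ y ∈ (finite_ball x R).toFinset, D (δ y (φ.1 y)) x := by
    rw [← Finset.sum_apply, ← _root_.map_sum, ← sub_eq_zero, ← Pi.sub_apply, ← _root_.map_sub]
    by_contra hne
    obtain ⟨z, hz, hxz⟩ := Metric.mem_thickening_iff.1 (hR _ hne)
    refine hz ?_
    have hz' : z ∈ (finite_ball x R).toFinset := by
      simpa [dist_comm] using hxz
    have h2 : (∑ y ∈ (finite_ball x R).toFinset, δ y (φ.1 y)).1 z = φ.1 z := by
      rw [Submodule.coe_sum, Finset.sum_apply, Finset.sum_eq_single z]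
      · exact Pi.single_eq_same (M := F) z (φ.1 z)
      · intro y _ hy
        exact Pi.single_eq_of_ne (M := F) hy.symm _
      · exact fun h => absurd hz' h
    rw [Submodule.coe_sub, Pi.sub_apply, h2, sub_self]
  calc ‖D φ x‖ ^ 2 ≤ (∑ y ∈ (finite_ball x R).toFinset, c y * ‖φ.1 y‖) ^ 2 := by
        refine pow_le_pow_left₀ (norm_nonneg _) ?_ 2
        rw [h1]
        exact (norm_sum_le _ _).trans (Finset.sum_le_sum fun y _ => hc y _)
    _ ≤ _ := Finset.sum_mul_sq_le_sq_mul_sq _ _ _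

theorem two_toReal_pos : (0 : ℝ) < (2 : ENNReal).toReal := by simp

/-- A `Γ`-invariant operator of finite propagation speed is bounded for the `L²`-norm. -/
theorem exists_l2_bound [Finite (MulAction.orbitRel.Quotient Γ Y)] [MetricSpace Y]
    [IsIsometricSMul Γ Y] [DiscreteTopology Y] [ProperSpace Y] [∀ y, FiniteDimensional ℂ (F y)]
    {D : CompactSections F →ₗ[ℂ] (∀ y, F y)} (hD : IsGammaInvariant A D)
    (hR : HasFinitePropagationSpeed D) :
    ∃ C : ℝ, ∀ φ : CompactSections F, ‖toL2 (compactEnd D hR φ)‖ ≤ C * ‖toL2 φ‖ := by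
  classical
  obtain ⟨R, hR0, hR'⟩ := id hR
  have := Fintype.ofFinite (MulAction.orbitRel.Quotient Γ Y)
  let B : Y → Finset Y := fun x => (finite_ball x R).toFinset
  have hB : ∀ x y, y ∈ B x ↔ dist y x < R := fun x y => by simp [B]
  choose m hm0 hm using fun x => local_bound hR' x
  have horb : ∀ x : Y, ∃ (o : MulAction.orbitRel.Quotient Γ Y) (g : Γ), x = g • o.out := by
    intro x
    obtain ⟨g, hg⟩ : (Quotient.mk'' x : MulAction.orbitRel.Quotient Γ Y).out
        ∈ MulAction.orbit Γ x :=
      MulAction.orbitRel_apply.1 (Quotient.mk_out (s := MulAction.orbitRel Γ Y) x)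
    refine ⟨Quotient.mk'' x, g⁻¹, ?_⟩
    rw [← hg]
    simp
  have hBg : ∀ (g : Γ) (s : Y) (f : Y → ℝ), ∑ y ∈ B s, f (g • y) = ∑ y ∈ B (g • s), f y := by
    intro g s f
    refine Finset.sum_nbij' (g • ·) (g⁻¹ • ·) ?_ ?_ ?_ ?_ ?_
    · intro y hy
      rw [hB] at hy ⊢
      rwa [dist_smul]
    · intro y hy
      rw [hB] at hy ⊢
      rw [← dist_smul g, smul_inv_smul]
      exact hy
    · intro y _; simp
    · intro y _; simp
    · intro y _; rfl
  let M : ℝ := ∑ o : MulAction.orbitRel.Quotient Γ Y, m o.out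
  have hM0 : 0 ≤ M := Finset.sum_nonneg fun o _ => hm0 _
  have hM : ∀ (x : Y) (φ : CompactSections F), ‖D φ x‖ ^ 2 ≤ M * ∑ y ∈ B x, ‖φ.1 y‖ ^ 2 := by
    intro x φ
    obtain ⟨o, g, rfl⟩ := horb x
    have h1 := hm o.out (actc A g⁻¹ φ)
    rw [hD] at h1
    have h2 : ∀ y, ‖(actc A g⁻¹ φ).1 y‖ = ‖φ.1 (g • y)‖ := fun y => norm_act_inv A g φ.1 y
    rw [norm_act_inv] at h1
    simp_rw [h2] at h1
    have h3 := hBg g o.out fun z => ‖φ.1 z‖ ^ 2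
    rw [← h3]
    refine h1.trans ?_
    refine mul_le_mul_of_nonneg_right ?_ (Finset.sum_nonneg fun _ _ => sq_nonneg _)
    exact Finset.single_le_sum (f := fun o : MulAction.orbitRel.Quotient Γ Y => m o.out)
      (fun o _ => hm0 _) (Finset.mem_univ o)
  let n : ℝ := ∑ o : MulAction.orbitRel.Quotient Γ Y, ((B o.out).card : ℝ)
  have hn0 : 0 ≤ n := Finset.sum_nonneg fun o _ => Nat.cast_nonneg _
  have hn : ∀ x, ((B x).card : ℝ) ≤ n := by
    intro x
    obtain ⟨o, g, rfl⟩ := horb x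
    have h1 := hBg g o.out fun _ => 1
    simp only [Finset.sum_const, nsmul_eq_mul, mul_one] at h1
    rw [← h1]
    exact Finset.single_le_sum
      (f := fun o : MulAction.orbitRel.Quotient Γ Y => ((B o.out).card : ℝ))
      (fun o _ => Nat.cast_nonneg _) (Finset.mem_univ o)
  refine ⟨Real.sqrt (M * n), fun φ => ?_⟩
  have h2 : (0 : ℝ) < (2 : ENNReal).toReal := two_toReal_pos
  refine lp.norm_le_of_forall_sum_le h2 (mul_nonneg (Real.sqrt_nonneg _) (norm_nonneg _))
    fun s => ?_
  have hsum := lp.sum_rpow_le_norm_rpow h2 (toL2 φ) (s.biUnion B)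
  simp only [ENNReal.toReal_ofNat, Real.rpow_ofNat] at hsum ⊢
  rw [mul_pow, Real.sq_sqrt (mul_nonneg hM0 hn0)]
  calc ∑ x ∈ s, ‖toL2 (compactEnd D hR φ) x‖ ^ 2
      ≤ ∑ x ∈ s, M * ∑ y ∈ B x, ‖φ.1 y‖ ^ 2 := Finset.sum_le_sum fun x _ => hM x φ
    _ = M * ∑ x ∈ s, ∑ y ∈ s.biUnion B, if y ∈ B x then ‖φ.1 y‖ ^ 2 else 0 := by
        rw [← Finset.mul_sum]
        congr 1
        refine Finset.sum_congr rfl fun x hx => ?_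
        rw [← Finset.sum_filter]
        congr 1
        ext y
        simp only [Finset.mem_filter, Finset.mem_biUnion]
        exact ⟨fun h => ⟨⟨x, hx, h⟩, h⟩, fun h => h.2⟩
    _ = M * ∑ y ∈ s.biUnion B, ∑ x ∈ s, if y ∈ B x then ‖φ.1 y‖ ^ 2 else 0 := by
        rw [Finset.sum_comm]
    _ ≤ M * ∑ y ∈ s.biUnion B, n * ‖φ.1 y‖ ^ 2 := by
        refine mul_le_mul_of_nonneg_left (Finset.sum_le_sum fun y _ => ?_) hM0
        rw [← Finset.sum_filter, Finset.sum_const, nsmul_eq_mul]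
        refine mul_le_mul_of_nonneg_right (le_trans ?_ (hn y)) (sq_nonneg _)
        refine Nat.cast_le.2 (Finset.card_le_card fun x hx => ?_)
        rw [Finset.mem_filter, hB, dist_comm] at hx
        exact (hB _ _).2 hx.2
    _ ≤ M * n * ‖toL2 φ‖ ^ 2 := by
        rw [← Finset.mul_sum, mul_assoc]
        exact mul_le_mul_of_nonneg_left (mul_le_mul_of_nonneg_left hsum hn0) hM0

/-- On compactly supported sections, the `L²`-extension of `D` is `D`. -/
theorem l2Extension_toL2 [Finite (MulAction.orbitRel.Quotient Γ Y)] [MetricSpace Y]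
    [IsIsometricSMul Γ Y] [DiscreteTopology Y] [ProperSpace Y] [∀ y, FiniteDimensional ℂ (F y)]
    {D : CompactSections F →ₗ[ℂ] (∀ y, F y)} (hD : IsGammaInvariant A D)
    (hR : HasFinitePropagationSpeed D) (φ : CompactSections F) :
    l2Extension D hR (toL2 φ) = toL2 (compactEnd D hR φ) := by
  obtain ⟨C, hC⟩ := exists_l2_bound A hD hR
  unfold l2Extension
  rw [LinearMap.extendOfNorm_eq (f := toL2 ∘ₗ compactEnd D hR) denseRange_toL2 ⟨C, ?_⟩ φ]
  · rw [LinearMap.comp_apply]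
  · intro ψ
    rw [LinearMap.comp_apply]
    exact hC ψ

end Action

/-! ## Traces, complex powers and determinants -/

section Determinant

/-- The complex power `a ^ w` of an element `a` of a Banach algebra whose spectrum lies in the open
right half-plane, defined by the holomorphic functional calculus
`(2πi)⁻¹ ∮ z ^ w (z - a)⁻¹ dz` with the principal branch of `z ^ w`. The contour is a circle inside
the open right half-plane with the spectrum in its interior; such a circle exists because the
spectrum is compact, and the integral does not depend on it. -/
noncomputable def holomorphicPower {𝔸 : Type*} [NormedRing 𝔸] [NormedAlgebra ℂ 𝔸] (a : 𝔸) (w : ℂ) :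
    𝔸 :=
  open Classical in
  if h : ∃ p : ℝ × ℝ, 0 < p.2 ∧ p.2 < p.1 ∧ spectrum ℂ a ⊆ Metric.ball (p.1 : ℂ) p.2 then
    (2 * Real.pi * Complex.I : ℂ)⁻¹ •
      ∮ z in C((h.choose.1 : ℂ), h.choose.2), z ^ w • resolvent a z
  else 0

variable (Γ : Type u) [Group Γ] {Y : Type v} [MulAction Γ Y] {F : Y → Type w}
  [∀ y, NormedAddCommGroup (F y)] [∀ y, InnerProductSpace ℂ (F y)]

/-- Extension by zero of sections over the set `S = {o.out}` of representatives of `Γ \ Y`. -/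
noncomputable def extendByZero [Finite (MulAction.orbitRel.Quotient Γ Y)] :
    (∀ o : MulAction.orbitRel.Quotient Γ Y, F o.out) →ₗ[ℂ] L2 F :=
  open Classical in
  letI := Fintype.ofFinite (MulAction.orbitRel.Quotient Γ Y)
  ∑ o : MulAction.orbitRel.Quotient Γ Y, (lp.lsingle 2 o.out) ∘ₗ LinearMap.proj o

/-- Restriction of sections to the set `S = {o.out}` of representatives of `Γ \ Y`. -/
noncomputable def restrictToReps : L2 F →ₗ[ℂ] (∀ o : MulAction.orbitRel.Quotient Γ Y, F o.out) where
  toFun f o := f o.out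
  map_add' _ _ := rfl
  map_smul' _ _ := rfl

/-- The trace `tr_Γ` of a (`Γ`-invariant) bounded operator on the square integrable sections.
Identify `L²(F)` with `L²(Γ) ⊗ L²(F|_S)` by means of a set `S` of representatives of `Γ \ Y`, and
write `T` as a series of elementary tensors `L_γ ⊗ T_γ`. Then `(τ ⊗ tr) T` is the trace of the
coefficient `T_e` at the unit element, since `τ (∑ c_γ L_γ) = c_e`; and `T_e` is the compression
of `T` to `L²(F|_S)`. -/
noncomputable def gammaTrace [Finite (MulAction.orbitRel.Quotient Γ Y)] (T : L2 F →L[ℂ] L2 F) : ℂ :=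
  LinearMap.trace ℂ (∀ o : MulAction.orbitRel.Quotient Γ Y, F o.out)
    (restrictToReps Γ ∘ₗ T.toLinearMap ∘ₗ extendByZero Γ)

/-- The zeta function `ζ_{T,Γ}(s) = tr_Γ (T ^ (-s))`. -/
noncomputable def gammaZeta [Finite (MulAction.orbitRel.Quotient Γ Y)] (T : L2 F →L[ℂ] L2 F)
    (s : ℂ) : ℂ :=
  gammaTrace Γ (holomorphicPower T (-s))

/-- The `L²`-determinant `det_Γ T = exp (-ζ_{T,Γ}'(0))`. -/
noncomputable def gammaDet [Finite (MulAction.orbitRel.Quotient Γ Y)] (T : L2 F →L[ℂ] L2 F) : ℂ :=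
  Complex.exp (-deriv (gammaZeta Γ T) 0)

/-- The open half-plane `Re z > C`. -/
def halfPlane (C : ℝ) : Set ℂ := {z | C < z.re}

/-- `f` is, on the half-plane `Re z > C`, the standard `N`-th root of `z ↦ det (T + z)`:
a holomorphic `N`-th root, normalized by `f t / |f t| → 1` as `t → +∞` along the real axis. -/
structure IsStandardRoot {V : Type*} [AddCommGroup V] [Module ℂ V] (T : Module.End ℂ V) (N : ℕ)
    (C : ℝ) (f : ℂ → ℂ) : Prop where
  holomorphic : DifferentiableOn ℂ f (halfPlane C)
  pow_eq : ∀ z ∈ halfPlane C, f z ^ N = LinearMap.det (T + algebraMap ℂ (Module.End ℂ V) z)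
  normalized : Tendsto (fun t : ℝ => f t / (‖f t‖ : ℂ)) atTop (𝓝 1)

end Determinant

/-- A tower of subgroups of `Γ`: a decreasing sequence of normal subgroups of finite index that
starts with `Γ` and has trivial intersection. -/
structure Tower (Γ : Type u) [Group Γ] where
  subgroup : ℕ → Subgroup Γ
  zero_eq : subgroup 0 = ⊤
  antitone : Antitone subgroup
  iInf_eq : ⨅ j, subgroup j = ⊥
  normal : ∀ j, (subgroup j).Normal
  finiteIndex : ∀ j, (subgroup j).FiniteIndex

instance instFiniteIndexTower {Γ : Type u} [Group Γ] (Λ : Tower Γ) (j : ℕ) :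
    (Λ.subgroup j).FiniteIndex :=
  Λ.finiteIndex j

end DiscreteSheaf

open DiscreteSheaf

/-!
The point is that for large `Re z` everything is governed by the moments of `D`, and that each
normalized moment of the pushdown `D_j` is eventually *equal* to the corresponding moment of `D`.

*Moments.* Translates of a set of representatives of `Γ \ Y` by coset representatives of `Γ_j` form
a set of representatives of `Γ_j \ Y`. Cutting the trace of `D_j ^ n` accordingly and using
invariance gives `[Γ : Γ_j]` equal summands, each the trace of the compression of `S ∘ D ^ n` to
`Γ \ Y` (`trace_eq_index_mul_trace_compression`). Sections supported on representatives are spanned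
by finitely many, and `D ^ n` maps each of them to a section of finite support; so, since the tower
has trivial intersection, only the unit element contributes to `S` for large `j`, and the summand
is `tr_Γ (D ^ n)` (`eventually_trace_pushdown_pow`).

*A uniform bound.* An invariant operator of finite propagation speed is bounded for the supremum
norm. An invariant section attains its supremum, hence one constant `M` bounds the eigenvalues of
all pushdowns (`exists_bound_roots_charpoly_pushdown`).

*Finite level.* For `‖z‖ > M` a standard root of `det (D_j + z) = ∏ (z + μ)` is
`z ^ d * exp ([Γ : Γ_j]⁻¹ ∑ log (1 + μ / z))`, where `d` is the dimension of the space of sections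
over `Γ \ Y` and `μ` runs through the eigenvalues of `D_j` with multiplicity; the
exponent expands in the normalized moments
`[Γ : Γ_j]⁻¹ tr (D_j ^ n) = [Γ : Γ_j]⁻¹ ∑ μ ^ n`. Standard roots are unique on the half-plane, as
two of them differ by a constant root of unity that the normalization fixes
(`DiscreteSheaf.IsStandardRoot.eqOn`).

*The `L²`-determinant.* Differentiating `z ^ (-s)` under the contour integral shows that
`-ζ'(0) = tr_Γ (log (D + z))`. The contour in the definition of complex powers is an unspecified
circle. On polynomials the contour integral is the polynomial functional calculus, whatever the
circle, and the logarithm is a uniform limit of polynomials on any disc that is compactly contained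
in the right half-plane; so the logarithm can be computed from its Taylor series at `z`
(`tendsto_aeval_logTaylor`). Hence `det_Γ (D + z) = z ^ d * exp (∑ (-1)^(n+1) tr_Γ (D^n) / (n z^n))`
(`gammaDet_eq`).

*Convergence.* The exponents are now series in `z⁻¹` whose coefficients stabilize one at a time
under a common geometric bound, so they converge uniformly (`tendstoUniformlyOn_log_series`).
-/

/-! ### Characteristic roots of powers and shifts of an endomorphism -/

section CharacteristicRoots

variable {V : Type*} [AddCommGroup V] [Module ℂ V] [FiniteDimensional ℂ V]

theorem card_roots_charpoly (P : Module.End ℂ V) :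
    P.charpoly.roots.card = Module.finrank ℂ V := by
  rw [← LinearMap.charpoly_natDegree P]
  exact (IsAlgClosed.splits P.charpoly).natDegree_eq_card_roots.symm

theorem eval_charpoly_eq_prod_roots (P : Module.End ℂ V) (t : ℂ) :
    P.charpoly.eval t = (P.charpoly.roots.map fun μ => t - μ).prod := by
  conv_lhs => rw [(IsAlgClosed.splits P.charpoly).eq_prod_roots]
  simp [P.charpoly_monic.leadingCoeff, Polynomial.eval_multiset_prod, Multiset.map_map]

theorem det_sub_algebraMap_eq_prod_roots (P : Module.End ℂ V) (r : ℂ) :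
    LinearMap.det (P - algebraMap ℂ (Module.End ℂ V) r) =
      (P.charpoly.roots.map fun μ => μ - r).prod := by
  have h1 : P - algebraMap ℂ (Module.End ℂ V) r
      = (-1 : ℂ) • (algebraMap ℂ (Module.End ℂ V) r - P) := by simp
  rw [h1, LinearMap.det_smul, ← LinearMap.eval_charpoly, eval_charpoly_eq_prod_roots,
    ← card_roots_charpoly P, ← Multiset.card_map (fun μ => r - μ), ← Multiset.prod_map_neg,
    Multiset.map_map]
  simp

/-- The spectral mapping theorem with multiplicities, in determinant form. -/
theorem det_aeval_eq_prod_roots (P : Module.End ℂ V) (p : Polynomial ℂ) :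
    LinearMap.det (Polynomial.aeval P p) = (P.charpoly.roots.map fun μ => p.eval μ).prod := by
  have hp := (IsAlgClosed.splits p).eq_prod_roots
  generalize p.leadingCoeff = a at hp
  generalize p.roots = s at hp
  subst hp
  simp only [map_mul, Polynomial.aeval_C, Polynomial.eval_mul, Polynomial.eval_C,
    Multiset.prod_map_mul, Multiset.map_const', Multiset.prod_replicate, card_roots_charpoly]
  congr 1
  · rw [Algebra.algebraMap_eq_smul_one, LinearMap.det_smul, map_one, mul_one]
  · induction s using Multiset.induction with
    | empty => simp
    | cons r s ih => simp [Polynomial.eval_mul, det_sub_algebraMap_eq_prod_roots, ih]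

theorem det_add_algebraMap_eq_prod_roots (P : Module.End ℂ V) (z : ℂ) :
    LinearMap.det (P + algebraMap ℂ (Module.End ℂ V) z) =
      (P.charpoly.roots.map fun μ => μ + z).prod := by
  simpa using det_sub_algebraMap_eq_prod_roots P (-z)

/-- By `det_aeval_eq_prod_roots` for the polynomials `t - X ^ n`, the characteristic roots of
`P ^ n` are the `n`-th powers of those of `P`. -/
theorem trace_pow_eq_sum_roots (P : Module.End ℂ V) (n : ℕ) :
    LinearMap.trace ℂ V (P ^ n) = (P.charpoly.roots.map fun μ => μ ^ n).sum := by
  have h : (P ^ n).charpoly = ((P.charpoly.roots.map fun μ => μ ^ n).map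
      fun a => Polynomial.X - Polynomial.C a).prod := by
    refine Polynomial.funext fun t => ?_
    have h2 := det_aeval_eq_prod_roots P (Polynomial.C t - Polynomial.X ^ n)
    rw [LinearMap.eval_charpoly, Polynomial.eval_multiset_prod, Multiset.map_map, Multiset.map_map]
    simpa using h2
  rw [Module.End.trace_eq_sum_roots_charpoly_of_splits (IsAlgClosed.splits _), h,
    Polynomial.roots_multiset_prod_X_sub_C]

end CharacteristicRoots

/-! ### Standard roots of characteristic determinants -/

section StandardRoots

theorem isOpen_halfPlane (C : ℝ) : IsOpen (halfPlane C) :=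
  isOpen_lt continuous_const Complex.continuous_re

theorem convex_halfPlane (C : ℝ) : Convex ℝ (halfPlane C) :=
  convex_halfSpace_re_gt C

theorem lt_norm_of_mem_halfPlane {C : ℝ} {z : ℂ} (hz : z ∈ halfPlane C) : C < ‖z‖ :=
  lt_of_lt_of_le hz (Complex.re_le_norm z)

theorem ofReal_mem_halfPlane {C t : ℝ} (ht : C < t) : (t : ℂ) ∈ halfPlane C := by
  simpa [halfPlane] using ht

/-- Two standard roots differ by a locally constant root of unity, which the normalization along
the real axis forces to be `1`. -/
theorem DiscreteSheaf.IsStandardRoot.eqOn {V : Type*} [AddCommGroup V] [Module ℂ V]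
    {T : Module.End ℂ V} {N : ℕ} (hN : N ≠ 0) {C : ℝ} {f g : ℂ → ℂ}
    (hf : IsStandardRoot T N C f) (hg : IsStandardRoot T N C g)
    (hdet : ∀ z ∈ halfPlane C, LinearMap.det (T + algebraMap ℂ (Module.End ℂ V) z) ≠ 0) :
    Set.EqOn f g (halfPlane C) := by
  have hg0 : ∀ z ∈ halfPlane C, g z ≠ 0 := fun z hz h => hdet z hz <| by
    rw [← hg.pow_eq z hz, h, zero_pow hN]
  have hfin : {w : ℂ | w ^ N = 1}.Finite := by
    refine (Polynomial.nthRoots N (1 : ℂ)).toFinset.finite_toSet.subset fun w hw => ?_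
    simpa [Polynomial.mem_nthRoots (Nat.pos_of_ne_zero hN)] using hw
  have hmaps : Set.MapsTo (fun z => f z / g z) (halfPlane C) {w : ℂ | w ^ N = 1} := by
    intro z hz
    change (f z / g z) ^ N = 1
    rw [div_pow, hf.pow_eq z hz, hg.pow_eq z hz, div_self (hdet z hz)]
  have hcont : ContinuousOn (fun z => f z / g z) (halfPlane C) :=
    hf.holomorphic.continuousOn.div hg.holomorphic.continuousOn hg0
  have hmem : ((C + 1 : ℝ) : ℂ) ∈ halfPlane C := ofReal_mem_halfPlane (by linarith)
  obtain ⟨ζ, hζ⟩ : ∃ ζ : ℂ, ∀ z ∈ halfPlane C, f z / g z = ζ := ⟨_, fun z hz =>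
    (convex_halfPlane C).isPreconnected.constant_of_mapsTo hfin.isDiscrete hcont hmaps hz hmem⟩
  have hfg : ∀ z ∈ halfPlane C, f z = ζ * g z := fun z hz => by
    rw [← hζ z hz, div_mul_cancel₀ _ (hg0 z hz)]
  have hζN : ζ ^ N = 1 := by
    rw [← hζ _ hmem]
    exact hmaps hmem
  have hζnorm : ‖ζ‖ = 1 := Complex.norm_eq_one_of_pow_eq_one hζN hN
  have hlim : Tendsto (fun t : ℝ => f t / (‖f t‖ : ℂ)) atTop (𝓝 (ζ * 1)) := by
    refine (hg.normalized.const_mul ζ).congr' ?_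
    filter_upwards [eventually_gt_atTop C] with t ht
    rw [hfg _ (ofReal_mem_halfPlane ht), norm_mul, hζnorm, one_mul, mul_div_assoc]
  have hζ1 : ζ = 1 := by simpa using tendsto_nhds_unique hlim hf.normalized
  intro z hz
  rw [hfg z hz, hζ1, one_mul]

theorem one_add_div_mem_slitPlane {μ z : ℂ} (h : ‖μ‖ < ‖z‖) : 1 + μ / z ∈ Complex.slitPlane := by
  refine Complex.mem_slitPlane_of_norm_lt_one ?_
  rw [norm_div]
  exact (div_lt_one ((norm_nonneg _).trans_lt h)).2 h

/-- For `‖z‖` larger than all elements of `s`, the logarithm of `∏ (1 + μ / z)` expands in the power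
sums of `s`. -/
theorem hasSum_sum_log_one_add_div (s : Multiset ℂ) {M : ℝ} (hs : ∀ μ ∈ s, ‖μ‖ ≤ M) {z : ℂ}
    (hz : M < ‖z‖) :
    HasSum (fun n : ℕ => (-1) ^ (n + 1) * ((s.map fun μ => μ ^ n).sum / z ^ n) / n)
      (s.map fun μ => Complex.log (1 + μ / z)).sum := by
  induction s using Multiset.induction with
  | empty => simp
  | cons μ s ih =>
    have h1 : ‖μ / z‖ < 1 := by
      have h := (hs μ (Multiset.mem_cons_self μ s)).trans_lt hz
      rw [norm_div]
      exact (div_lt_one ((norm_nonneg _).trans_lt h)).2 h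
    have h2 := (Complex.hasSum_taylorSeries_log h1).add
      (ih fun ν hν => hs ν (Multiset.mem_cons_of_mem hν))
    simp only [Multiset.map_cons, Multiset.sum_cons]
    refine h2.congr_fun ?_
    intro n
    rw [div_pow]
    ring

theorem tendsto_sum_log_one_add_div (s : Multiset ℂ) :
    Tendsto (fun t : ℝ => (s.map fun μ => Complex.log (1 + μ / (t : ℂ))).sum) atTop (𝓝 0) := by
  induction s using Multiset.induction with
  | empty => simp
  | cons μ s ih =>
    have h1 : Tendsto (fun t : ℝ => 1 + μ / (t : ℂ)) atTop (𝓝 1) := by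
      have h2 : Tendsto (fun t : ℝ => ((t⁻¹ : ℝ) : ℂ)) atTop (𝓝 ((0 : ℝ) : ℂ)) :=
        (Complex.continuous_ofReal.tendsto 0).comp tendsto_inv_atTop_zero
      have h3 := (h2.const_mul μ).const_add 1
      simpa [div_eq_mul_inv] using h3
    have h4 := (h1.clog (by simp)).add ih
    simpa using h4

theorem differentiableOn_sum_log_one_add_div (s : Multiset ℂ) {C : ℝ} (hs : ∀ μ ∈ s, ‖μ‖ ≤ C)
    (hC : 0 ≤ C) :
    DifferentiableOn ℂ (fun z => (s.map fun μ => Complex.log (1 + μ / z)).sum) (halfPlane C) := by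
  induction s using Multiset.induction with
  | empty => simp
  | cons μ s ih =>
    simp only [Multiset.map_cons, Multiset.sum_cons]
    refine DifferentiableOn.add ?_ (ih fun ν hν => hs ν (Multiset.mem_cons_of_mem hν))
    refine DifferentiableOn.clog ?_ fun z hz => one_add_div_mem_slitPlane
      ((hs μ (Multiset.mem_cons_self μ s)).trans_lt (lt_norm_of_mem_halfPlane hz))
    refine (differentiableOn_const _).add ((differentiableOn_const _).div differentiableOn_id ?_)
    exact fun z hz => norm_pos_iff.1 (hC.trans_lt (lt_norm_of_mem_halfPlane hz))

variable {V : Type*} [AddCommGroup V] [Module ℂ V] [FiniteDimensional ℂ V]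

theorem det_add_algebraMap_ne_zero {T : Module.End ℂ V} {z : ℂ}
    (hT : ∀ μ ∈ T.charpoly.roots, ‖μ‖ < ‖z‖) :
    LinearMap.det (T + algebraMap ℂ (Module.End ℂ V) z) ≠ 0 := by
  rw [det_add_algebraMap_eq_prod_roots]
  refine Multiset.prod_ne_zero fun h => ?_
  obtain ⟨μ, hμ, h0⟩ := Multiset.mem_map.1 h
  have := hT μ hμ
  rw [eq_neg_of_add_eq_zero_left h0, norm_neg] at this
  exact lt_irrefl _ this

/-- The explicit `N`-th root `z ^ d * exp (N⁻¹ ∑ log (1 + μ / z))` of `z ↦ det (T + z)`, where `μ`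
runs through the characteristic roots of `T` and `N * d` is the dimension. -/
noncomputable def standardRoot (T : Module.End ℂ V) (N d : ℕ) (z : ℂ) : ℂ :=
  z ^ d * Complex.exp ((N : ℂ)⁻¹ * (T.charpoly.roots.map fun μ => Complex.log (1 + μ / z)).sum)

/-- Every factor `μ + z = z * (1 + μ / z)` contributes `1` to the power of `z`, and the second
factor lies in the slit plane because `‖μ‖ < ‖z‖`. -/
theorem isStandardRoot_standardRoot {T : Module.End ℂ V} {N d : ℕ} (hN : N ≠ 0)
    (hd : Module.finrank ℂ V = N * d) {C : ℝ} (hC : 0 ≤ C)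
    (hT : ∀ μ ∈ T.charpoly.roots, ‖μ‖ ≤ C) : IsStandardRoot T N C (standardRoot T N d) where
  holomorphic :=
    (differentiableOn_id.pow d).mul
      ((differentiableOn_sum_log_one_add_div _ hT hC).const_mul _).cexp
  pow_eq z hz := by
    have hz0 : z ≠ 0 := norm_pos_iff.1 (hC.trans_lt (lt_norm_of_mem_halfPlane hz))
    have hN' : (N : ℂ) ≠ 0 := Nat.cast_ne_zero.2 hN
    rw [standardRoot, mul_pow, ← Complex.exp_nat_mul, mul_inv_cancel_left₀ hN', ← pow_mul,
      mul_comm d N, ← hd, ← card_roots_charpoly T, det_add_algebraMap_eq_prod_roots]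
    generalize T.charpoly.roots = s at hT ⊢
    induction s using Multiset.induction with
    | empty => simp
    | cons μ s ih =>
      have h1 : 1 + μ / z ≠ 0 := Complex.slitPlane_ne_zero <| one_add_div_mem_slitPlane
        ((hT μ (Multiset.mem_cons_self μ s)).trans_lt (lt_norm_of_mem_halfPlane hz))
      have h2 : μ + z = z * (1 + μ / z) := by field_simp; ring
      simp only [Multiset.map_cons, Multiset.sum_cons, Multiset.prod_cons, Multiset.card_cons,
        Complex.exp_add, Complex.exp_log h1]
      rw [← ih fun ν hν => hT ν (Multiset.mem_cons_of_mem hν), h2]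
      ring
  normalized := by
    have h1 : Tendsto (fun t : ℝ => Complex.exp ((N : ℂ)⁻¹ *
        (T.charpoly.roots.map fun μ => Complex.log (1 + μ / (t : ℂ))).sum)) atTop (𝓝 1) := by
      have h2 := ((tendsto_sum_log_one_add_div T.charpoly.roots).const_mul (N : ℂ)⁻¹).cexp
      simpa using h2
    have h3 : Tendsto (fun w : ℂ => w / (‖w‖ : ℂ)) (𝓝 1) (𝓝 (1 / ((‖(1 : ℂ)‖ : ℝ) : ℂ))) := by
      refine Tendsto.div tendsto_id ?_ (by simp)
      exact (Complex.continuous_ofReal.comp continuous_norm).tendsto 1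
    have h4 := h3.comp h1
    rw [norm_one, Complex.ofReal_one, div_one] at h4
    refine h4.congr' ?_
    filter_upwards [eventually_gt_atTop 0] with t ht
    have ht' : ((t : ℂ)) ^ d ≠ 0 := pow_ne_zero _ (by exact_mod_cast ht.ne')
    simp only [Function.comp_apply, standardRoot, norm_mul, norm_pow, Complex.norm_real,
      Real.norm_of_nonneg ht.le, Complex.ofReal_mul, Complex.ofReal_pow]
    rw [mul_div_mul_left _ _ ht']

end StandardRoots

/-! ### Uniform convergence of logarithmic series -/

theorem norm_log_series_term_le {c z : ℂ} {C : ℝ} (hC : 0 < C) (hz : C ≤ ‖z‖) (n : ℕ) :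
    ‖(-1) ^ (n + 1) * (c / z ^ n) / n‖ ≤ ‖c‖ / C ^ n := by
  rcases Nat.eq_zero_or_pos n with rfl | hn
  · simp
  have hn' : (1 : ℝ) ≤ n := by exact_mod_cast hn
  simp only [norm_div, norm_mul, norm_pow, norm_neg, norm_one, one_pow, one_mul,
    RCLike.norm_natCast]
  refine (div_le_self (by positivity) hn').trans ?_
  gcongr

theorem summable_log_series {c : ℕ → ℂ} {B M C : ℝ} (hM : 0 ≤ M) (hMC : M < C)
    (hc : ∀ n, ‖c n‖ ≤ B * M ^ n) {z : ℂ} (hz : C ≤ ‖z‖) :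
    Summable fun n : ℕ => (-1) ^ (n + 1) * (c n / z ^ n) / n := by
  have hC : 0 < C := hM.trans_lt hMC
  refine Summable.of_norm_bounded (g := fun n => B * (M / C) ^ n)
    ((summable_geometric_of_lt_one (by positivity) ((div_lt_one hC).2 hMC)).mul_left B) fun n => ?_
  refine (norm_log_series_term_le hC hz n).trans ?_
  rw [div_pow, ← mul_div_assoc]
  gcongr
  exact hc n

/-- If the coefficients stabilize one at a time under a common geometric bound, the logarithmic
series converge uniformly outside a disc. -/
theorem tendstoUniformlyOn_log_series {c : ℕ → ℕ → ℂ} {c' : ℕ → ℂ} {B M C : ℝ} (hM : 0 ≤ M)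
    (hMC : M < C) (hc : ∀ j n, ‖c j n‖ ≤ B * M ^ n) (h : ∀ n, ∀ᶠ j in atTop, c j n = c' n) :
    TendstoUniformlyOn (fun j z => ∑' n : ℕ, (-1) ^ (n + 1) * (c j n / z ^ n) / n)
      (fun z => ∑' n : ℕ, (-1) ^ (n + 1) * (c' n / z ^ n) / n) atTop {z | C ≤ ‖z‖} := by
  have hC : 0 < C := hM.trans_lt hMC
  have hc' : ∀ n, ‖c' n‖ ≤ B * M ^ n := fun n => by
    obtain ⟨j, hj⟩ := (h n).exists
    exact hj ▸ hc j n
  have hgeom : Summable fun n : ℕ => 2 * B * (M / C) ^ n :=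
    (summable_geometric_of_lt_one (by positivity) ((div_lt_one hC).2 hMC)).mul_left _
  have hbound : ∀ j n, ‖c' n - c j n‖ / C ^ n ≤ 2 * B * (M / C) ^ n := fun j n => by
    rw [div_pow, ← mul_div_assoc]
    gcongr
    refine (norm_sub_le _ _).trans ?_
    linarith [hc j n, hc' n]
  have hlim : Tendsto (fun j => ∑' n, ‖c' n - c j n‖ / C ^ n) atTop (𝓝 (∑' _ : ℕ, (0 : ℝ))) := by
    refine tendsto_tsum_of_dominated_convergence hgeom (fun n => ?_)
      (Eventually.of_forall fun j n => ?_)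
    · refine tendsto_const_nhds.congr' ?_
      filter_upwards [h n] with j hj
      simp [hj]
    · rw [Real.norm_of_nonneg (by positivity)]
      exact hbound j n
  rw [tsum_zero] at hlim
  rw [Metric.tendstoUniformlyOn_iff]
  intro ε hε
  filter_upwards [hlim.eventually (gt_mem_nhds hε)] with j hj z hz
  rw [dist_eq_norm, ← (summable_log_series hM hMC hc' hz).tsum_sub
    (summable_log_series hM hMC (hc j) hz)]
  refine lt_of_le_of_lt (tsum_of_norm_bounded (Summable.of_nonneg_of_le (fun n => ?_) (hbound j)
    hgeom).hasSum fun n => ?_) hj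
  · positivity
  · rw [← sub_div, ← mul_sub, ← sub_div]
    exact norm_log_series_term_le hC hz n

/-! ### Holomorphic functional calculus on circles -/

section FunctionalCalculus

variable {𝔸 : Type*} [NormedRing 𝔸] [NormedAlgebra ℂ 𝔸]

theorem mem_resolventSet_of_notMem_ball {a : 𝔸} {c z : ℂ} {r : ℝ}
    (h : spectrum ℂ a ⊆ Metric.ball c r) (hz : z ∉ Metric.ball c r) : z ∈ resolventSet ℂ a := by
  by_contra hz'
  exact hz (h hz')

theorem smul_resolvent {a : 𝔸} {z : ℂ} (hz : z ∈ resolventSet ℂ a) :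
    z • resolvent a z = 1 + a * resolvent a z := by
  have h : (algebraMap ℂ 𝔸 z - a) * resolvent a z = 1 := Ring.mul_inverse_cancel _ hz
  rw [sub_mul, ← Algebra.smul_def] at h
  exact sub_eq_iff_eq_add.1 h

variable [CompleteSpace 𝔸]

theorem continuousOn_resolvent_sphere {a : 𝔸} {c : ℂ} {r : ℝ}
    (h : spectrum ℂ a ⊆ Metric.ball c r) : ContinuousOn (resolvent a) (Metric.sphere c r) :=
  fun z hz =>
    have hz' : z ∈ resolventSet ℂ a := mem_resolventSet_of_notMem_ball h (by
      rw [Metric.mem_ball, Metric.mem_sphere.1 hz]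
      exact lt_irrefl r)
    (spectrum.hasDerivAt_resolvent_const_left hz').continuousAt.continuousWithinAt

/-- The resolvent has residue `1` at infinity; the circle may be blown up because the resolvent is
holomorphic outside of it. -/
theorem circleIntegral_resolvent {a : 𝔸} {c : ℂ} {r : ℝ} (hr : 0 < r)
    (h : spectrum ℂ a ⊆ Metric.ball c r) :
    (∮ z in C(c, r), resolvent a z) = (2 * Real.pi * Complex.I : ℂ) • (1 : 𝔸) := by
  have hdiff : ∀ z, z ∉ Metric.ball c r → DifferentiableAt ℂ (resolvent a) z := fun z hz =>
    (spectrum.hasDerivAt_resolvent_const_left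
      (mem_resolventSet_of_notMem_ball h hz)).differentiableAt
  -- subtract `(z - c)⁻¹`, which has integral `2πi`, from the resolvent
  have hexp : ∀ R : ℝ, r ≤ R → (∮ z in C(c, r), resolvent a z) -
      (2 * Real.pi * Complex.I : ℂ) • (1 : 𝔸) =
      ∮ z in C(c, R), (z - c)⁻¹ • ((a - algebraMap ℂ 𝔸 c) * resolvent a z) := by
    intro R hR
    have hR0 : 0 < R := hr.trans_le hR
    have hout : ∀ z ∈ Metric.sphere c R, z ∉ Metric.ball c r := fun z hz hz' => by
      rw [Metric.mem_ball, Metric.mem_sphere.1 hz] at hz'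
      exact absurd hz' (not_lt.2 hR)
    have hne : ∀ z ∈ Metric.sphere c R, z - c ≠ 0 := fun z hz h0 => by
      rw [sub_eq_zero.1 h0, Metric.mem_sphere, dist_self] at hz
      exact hR0.ne hz
    have hinv : ContinuousOn (fun z : ℂ => (z - c)⁻¹) (Metric.sphere c R) :=
      (continuousOn_id.sub continuousOn_const).inv₀ hne
    have hres : ContinuousOn (resolvent a) (Metric.sphere c R) := fun z hz =>
      (hdiff z (hout z hz)).continuousAt.continuousWithinAt
    rw [← Complex.circleIntegral_eq_of_differentiable_on_annulus_off_countable hr hR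
      Set.countable_empty
      (fun z hz => (hdiff z hz.2).continuousAt.continuousWithinAt)
      (fun z hz => hdiff z fun hz' => hz.1.2 (Metric.ball_subset_closedBall hz')),
      ← circleIntegral.integral_sub_center_inv c hR0.ne',
      ← circleIntegral.integral_smul_const, ← circleIntegral.integral_sub]
    · refine circleIntegral.integral_congr hR0.le fun z hz => ?_
      have h1 : (z - c) • resolvent a z = 1 + (a - algebraMap ℂ 𝔸 c) * resolvent a z := by
        rw [sub_smul, smul_resolvent (mem_resolventSet_of_notMem_ball h (hout z hz)), sub_mul,
          ← Algebra.smul_def, add_sub_assoc]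
      rw [← sub_eq_iff_eq_add'.2 h1, smul_sub, inv_smul_smul₀ (hne z hz)]
    · exact hres.circleIntegrable hR0.le
    · exact (hinv.smul continuousOn_const).circleIntegrable hR0.le
  -- the error term is `O(sup ‖resolvent‖)` on the large circle, and the resolvent vanishes at
  -- infinity
  have hzero : ∀ ε > 0, ‖(∮ z in C(c, r), resolvent a z) -
      (2 * Real.pi * Complex.I : ℂ) • (1 : 𝔸)‖ ≤ 2 * Real.pi * ‖a - algebraMap ℂ 𝔸 c‖ * ε := by
    intro ε hε
    have h1 := (spectrum.resolvent_tendsto_cobounded (𝕜 := ℂ) a).norm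
    rw [norm_zero] at h1
    have h2 := h1.eventually (gt_mem_nhds hε)
    obtain ⟨K, -, hK⟩ := (Metric.hasBasis_cobounded_compl_closedBall c).eventually_iff.1 h2
    set R := max r (K + 1)
    have hR0 : 0 < R := hr.trans_le (le_max_left _ _)
    rw [hexp R (le_max_left _ _)]
    refine (circleIntegral.norm_integral_le_of_norm_le_const hR0.le
      (C := R⁻¹ * (‖a - algebraMap ℂ 𝔸 c‖ * ε)) fun z hz => ?_).trans (le_of_eq ?_)
    · rw [norm_smul, norm_inv, ← dist_eq_norm, Metric.mem_sphere.1 hz]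
      gcongr
      refine (norm_mul_le _ _).trans ?_
      gcongr
      refine (hK ?_).le
      rw [Set.mem_compl_iff, Metric.mem_closedBall, Metric.mem_sphere.1 hz, not_le]
      exact (lt_add_one K).trans_le (le_max_right _ _)
    · field_simp
  rw [← sub_eq_zero, ← norm_le_zero_iff]
  have hlim : Tendsto (fun ε : ℝ => 2 * Real.pi * ‖a - algebraMap ℂ 𝔸 c‖ * ε) (𝓝[>] 0) (𝓝 0) := by
    have h1 := (continuous_const_mul (2 * Real.pi * ‖a - algebraMap ℂ 𝔸 c‖)).tendsto (0 : ℝ)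
    rw [mul_zero] at h1
    exact h1.mono_left nhdsWithin_le_nhds
  exact ge_of_tendsto hlim (eventually_nhdsWithin_of_forall hzero)

/-- On polynomials the contour integral is the polynomial functional calculus. -/
theorem circleIntegral_eval_smul_resolvent {a : 𝔸} {c : ℂ} {r : ℝ} (hr : 0 < r)
    (h : spectrum ℂ a ⊆ Metric.ball c r) (p : Polynomial ℂ) :
    (∮ z in C(c, r), p.eval z • resolvent a z) =
      (2 * Real.pi * Complex.I : ℂ) • Polynomial.aeval a p := by
  have hint : ∀ p : Polynomial ℂ, CircleIntegrable (fun z => p.eval z • resolvent a z) c r :=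
    fun p => (p.continuous.continuousOn.smul
      (continuousOn_resolvent_sphere h)).circleIntegrable hr.le
  induction p using Polynomial.induction_on with
  | C w =>
    simp only [Polynomial.eval_C, Polynomial.aeval_C]
    rw [circleIntegral.integral_smul, circleIntegral_resolvent hr h, Algebra.algebraMap_eq_smul_one,
      smul_comm]
  | add p q hp hq =>
    simp only [Polynomial.eval_add, add_smul, map_add, smul_add]
    rw [circleIntegral.integral_add (hint p) (hint q), hp, hq]
  | monomial n w ih =>
    set q : Polynomial ℂ := Polynomial.C w * Polynomial.X ^ n with hq
    have h1 : Polynomial.C w * Polynomial.X ^ (n + 1) = Polynomial.X * q := by rw [hq]; ring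
    rw [h1, map_mul, Polynomial.aeval_X, ← mul_smul_comm, ← ih]
    -- `z q(z) (z - a)⁻¹ = q(z) + a q(z) (z - a)⁻¹`, and `q` has no residues
    have h2 : (∮ z in C(c, r), q.eval z • (1 : 𝔸)) = 0 := by
      refine Complex.circleIntegral_eq_zero_of_differentiable_on_off_countable hr.le
        Set.countable_empty (by fun_prop) fun z _ => ?_
      exact q.differentiable.differentiableAt.smul_const _
    have h3 : a * (∮ z in C(c, r), q.eval z • resolvent a z) =
        ∮ z in C(c, r), a * (q.eval z • resolvent a z) := by
      have := ContinuousLinearMap.intervalIntegral_comp_comm (ContinuousLinearMap.mul ℂ 𝔸 a)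
        (hint q).out
      simp only [ContinuousLinearMap.mul_apply'] at this
      simp only [circleIntegral, ← this, mul_smul_comm]
    rw [h3, ← zero_add (∮ z in C(c, r), a * (q.eval z • resolvent a z)), ← h2,
      ← circleIntegral.integral_add]
    · refine circleIntegral.integral_congr hr.le fun z hz => ?_
      simp only [Polynomial.eval_mul, Polynomial.eval_X]
      rw [mul_comm, mul_smul, smul_resolvent (mem_resolventSet_of_notMem_ball h (by
        rw [Metric.mem_ball, Metric.mem_sphere.1 hz]; exact lt_irrefl r)), smul_add,
        mul_smul_comm]
    · exact (q.continuous.smul continuous_const).continuousOn.circleIntegrable hr.le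
    · exact (continuousOn_const.mul (q.continuous.continuousOn.smul
        (continuousOn_resolvent_sphere h))).circleIntegrable hr.le

/-- The contour integral of `f` is determined by any sequence of polynomials that converges to `f`
on the contour. -/
theorem tendsto_aeval_of_tendstoUniformlyOn {a : 𝔸} {c : ℂ} {r : ℝ} (hr : 0 < r)
    (h : spectrum ℂ a ⊆ Metric.ball c r) {p : ℕ → Polynomial ℂ} {f : ℂ → ℂ}
    (hp : TendstoUniformlyOn (fun n z => (p n).eval z) f atTop (Metric.sphere c r)) :
    Tendsto (fun n => Polynomial.aeval a (p n)) atTop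
      (𝓝 ((2 * Real.pi * Complex.I : ℂ)⁻¹ • ∮ z in C(c, r), f z • resolvent a z)) := by
  have hcont := continuousOn_resolvent_sphere h
  obtain ⟨K, hK⟩ := (isCompact_sphere c r).exists_bound_of_continuousOn hcont
  have h1 : TendstoUniformlyOn (fun n z => (p n).eval z • resolvent a z)
      (fun z => f z • resolvent a z) atTop (Metric.sphere c r) := by
    rw [Metric.tendstoUniformlyOn_iff] at hp ⊢
    intro ε hε
    have hK0 : 0 < |K| + 1 := by positivity
    filter_upwards [hp (ε / (|K| + 1)) (by positivity)] with n hn z hz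
    rw [dist_eq_norm, ← sub_smul, norm_smul, ← dist_eq_norm]
    calc dist (f z) ((p n).eval z) * ‖resolvent a z‖
        ≤ dist (f z) ((p n).eval z) * (|K| + 1) := by
          gcongr
          linarith [hK z hz, le_abs_self K]
      _ < ε / (|K| + 1) * (|K| + 1) := by
          gcongr
          exact hn z hz
      _ = ε := by field_simp
  have h2 := (h1.tendsto_circleIntegral_of_continuousOn hr.le (Eventually.of_forall fun n =>
    (p n).continuous.continuousOn.smul hcont)).const_smul (2 * Real.pi * Complex.I : ℂ)⁻¹
  refine h2.congr fun n => ?_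
  simp only [Pi.smul_apply']
  rw [circleIntegral_eval_smul_resolvent hr h, inv_smul_smul₀ Complex.two_pi_I_ne_zero]

end FunctionalCalculus

/-! ### The logarithm and complex powers -/

section Logarithm

/-- The Taylor polynomials of the logarithm at `w`. -/
noncomputable def logTaylor (w : ℂ) (n : ℕ) : Polynomial ℂ :=
  Polynomial.C (Complex.log w) + ∑ k ∈ Finset.range n,
    Polynomial.C ((-1) ^ (k + 1) / (w ^ k * k)) * (Polynomial.X - Polynomial.C w) ^ k

theorem tendstoUniformlyOn_logTaylor {w : ℂ} {r : ℝ} (hr : r < w.re) :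
    TendstoUniformlyOn (fun n z => (logTaylor w n).eval z) Complex.log atTop
      (Metric.closedBall w r) := by
  rcases lt_or_ge r 0 with h0 | h0
  · rw [Metric.closedBall_eq_empty.2 h0]
    exact tendstoUniformlyOn_empty
  have hw : r < ‖w‖ := hr.trans_le (Complex.re_le_norm w)
  have hw0 : 0 < ‖w‖ := h0.trans_lt hw
  have hq : r / ‖w‖ < 1 := (div_lt_one hw0).2 hw
  have hz : ∀ z ∈ Metric.closedBall w r, ‖(z - w) / w‖ ≤ r / ‖w‖ := fun z hz => by
    rw [norm_div, ← dist_eq_norm]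
    gcongr
    exact hz
  have h1 := tendstoUniformlyOn_tsum_nat
    (summable_geometric_of_lt_one (by positivity : 0 ≤ r / ‖w‖) hq)
    (f := fun (n : ℕ) (z : ℂ) => (-1) ^ (n + 1) * ((z - w) / w) ^ n / n)
    (s := Metric.closedBall w r) fun n z hzr => by
      rcases Nat.eq_zero_or_pos n with rfl | hn
      · simp
      have hn' : (1 : ℝ) ≤ n := by exact_mod_cast hn
      simp only [norm_div _ (n : ℂ), norm_mul, norm_pow, norm_neg, norm_one, one_pow, one_mul,
        RCLike.norm_natCast]
      refine (div_le_self (by positivity) hn').trans ?_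
      gcongr
      exact hz z hzr
  have h2 : TendstoUniformlyOn (fun (_ : ℕ) (_ : ℂ) => Complex.log w) (fun _ => Complex.log w) atTop
      (Metric.closedBall w r) := by
    rw [Metric.tendstoUniformlyOn_iff]
    intro ε hε
    simp [hε]
  refine ((h2.add h1).congr (Eventually.of_forall fun n z _ => ?_)).congr_right fun z hzr => ?_
  · simp only [logTaylor, Pi.add_apply, Polynomial.eval_add, Polynomial.eval_C,
      Polynomial.eval_finsetSum, Polynomial.eval_mul, Polynomial.eval_pow, Polynomial.eval_sub,
      Polynomial.eval_X, add_right_inj]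
    refine Finset.sum_congr rfl fun k _ => ?_
    rw [div_pow]
    ring
  · have hlt : ‖(z - w) / w‖ < 1 := (hz z hzr).trans_lt hq
    have hz0 : z = w * (1 + (z - w) / w) := by
      field_simp [norm_pos_iff.1 hw0]
      ring
    have hre : 0 < (1 + (z - w) / w).re := by
      have := (Complex.abs_re_le_norm ((z - w) / w)).trans_lt hlt
      rw [Complex.add_re, Complex.one_re]
      linarith [(abs_lt.1 this).1]
    simp only [Pi.add_apply]
    rw [(Complex.hasSum_taylorSeries_log hlt).tsum_eq]
    conv_rhs => rw [hz0]
    -- the arguments of both factors lie in `(-π/2, π/2)`, so the principal branch is additive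
    have ha := abs_lt.1 (Complex.abs_arg_lt_pi_div_two_iff.2 (Or.inl (h0.trans_lt hr)))
    have hb := abs_lt.1 (Complex.abs_arg_lt_pi_div_two_iff.2 (Or.inl hre))
    rw [Complex.log_mul (norm_pos_iff.1 hw0) (fun h => by simp [h] at hre)]
    exact ⟨by linarith, by linarith⟩

/-- A compact subset of the open right half-plane lies in a disc of the open right half-plane that
is centred on the real axis. -/
theorem exists_ball_of_isCompact_of_re_pos {K : Set ℂ} (hK : IsCompact K)
    (hre : ∀ w ∈ K, 0 < w.re) :
    ∃ p : ℝ × ℝ, 0 < p.2 ∧ p.2 < p.1 ∧ K ⊆ Metric.ball (p.1 : ℂ) p.2 := by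
  obtain ⟨δ, hδ, hδK⟩ := hK.exists_forall_le' Complex.continuous_re.continuousOn hre
  obtain ⟨B, hB, hBK⟩ := hK.isBounded.exists_pos_norm_le
  -- `‖w - c‖² = ‖w‖² - 2 c Re w + c² ≤ B² - 2 c δ + c²`, which for this `c` is `c² - B² - 2 δ²`
  set c : ℝ := (B ^ 2 + δ ^ 2) / δ with hc
  have hcδ : c * δ = B ^ 2 + δ ^ 2 := by rw [hc]; field_simp
  have hc0 : 0 < c := by positivity
  have hcδ' : δ < c := by nlinarith
  have hpos : 0 < c ^ 2 - B ^ 2 - δ ^ 2 := by nlinarith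
  refine ⟨(c, Real.sqrt (c ^ 2 - B ^ 2 - δ ^ 2)), Real.sqrt_pos.2 hpos, ?_, fun w hw => ?_⟩
  · rw [Real.sqrt_lt' hc0]
    nlinarith
  · rw [Metric.mem_ball, dist_eq_norm]
    refine Real.lt_sqrt_of_sq_lt ?_
    have h1 : ‖w - c‖ ^ 2 = ‖w‖ ^ 2 - 2 * c * w.re + c ^ 2 := by
      rw [← Complex.normSq_eq_norm_sq, ← Complex.normSq_eq_norm_sq, Complex.normSq_apply,
        Complex.normSq_apply]
      simp
      ring
    rw [h1]
    have h2 : ‖w‖ ^ 2 ≤ B ^ 2 := by gcongr; exact hBK w hw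
    nlinarith [hδK w hw]

theorem re_pos_of_mem_closedBall {w z : ℂ} {r : ℝ} (hr : r < w.re)
    (hz : z ∈ Metric.closedBall w r) : 0 < z.re := by
  have h1 : |(z - w).re| ≤ r := (Complex.abs_re_le_norm _).trans (by rwa [← dist_eq_norm])
  rw [Complex.sub_re] at h1
  linarith [(abs_le.1 h1).1]

variable {𝔸 : Type*} [NormedRing 𝔸] [NormedAlgebra ℂ 𝔸] [CompleteSpace 𝔸]

/-- The logarithm `(2πi)⁻¹ ∮ log z (z - a)⁻¹ dz` along a circle is the limit of the Taylor
polynomials at the centre of any other such circle: both are compared with the Taylor polynomials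
at the centre of a disc that contains both circles. -/
theorem tendsto_aeval_logTaylor {a : 𝔸} {c w : ℂ} {r ρ : ℝ} (hr : 0 < r) (hrc : r < c.re)
    (hρ : 0 < ρ) (hρw : ρ < w.re) (hc : spectrum ℂ a ⊆ Metric.ball c r)
    (hw : spectrum ℂ a ⊆ Metric.ball w ρ) :
    Tendsto (fun n => Polynomial.aeval a (logTaylor w n)) atTop
      (𝓝 ((2 * Real.pi * Complex.I : ℂ)⁻¹ • ∮ z in C(c, r), Complex.log z • resolvent a z)) := by
  obtain ⟨p, -, hp, hsub⟩ := exists_ball_of_isCompact_of_re_pos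
    ((isCompact_sphere c r).union (isCompact_sphere w ρ)) (fun z hz => hz.elim
      (fun hz => re_pos_of_mem_closedBall hrc (Metric.sphere_subset_closedBall hz))
      (fun hz => re_pos_of_mem_closedBall hρw (Metric.sphere_subset_closedBall hz)))
  have hT := tendstoUniformlyOn_logTaylor (w := (p.1 : ℂ)) (r := p.2) (by simpa using hp)
  have h1 := tendsto_aeval_of_tendstoUniformlyOn hr hc (hT.mono
    ((Set.subset_union_left.trans hsub).trans Metric.ball_subset_closedBall))
  have h2 := tendsto_aeval_of_tendstoUniformlyOn hρ hw (hT.mono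
    ((Set.subset_union_right.trans hsub).trans Metric.ball_subset_closedBall))
  rw [tendsto_nhds_unique h1 h2]
  exact tendsto_aeval_of_tendstoUniformlyOn hρ hw
    ((tendstoUniformlyOn_logTaylor hρw).mono Metric.sphere_subset_closedBall)

/-- Differentiation of `z ^ (-s)` at `s = 0` under the contour integral. -/
theorem hasDerivAt_circleIntegral_cpow_neg {E : Type*} [NormedAddCommGroup E] [NormedSpace ℂ E]
    {c : ℂ} {r : ℝ} (hr : 0 < r) (hrc : r < c.re) {f : ℂ → E}
    (hf : ContinuousOn f (Metric.sphere c r)) :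
    HasDerivAt (fun s : ℂ => ∮ z in C(c, r), z ^ (-s) • f z)
      (-∮ z in C(c, r), Complex.log z • f z) 0 := by
  have hre : ∀ t, 0 < (circleMap c r t).re := fun t => re_pos_of_mem_closedBall hrc
    (Metric.sphere_subset_closedBall (circleMap_mem_sphere c hr.le t))
  have hne : ∀ t, circleMap c r t ≠ 0 := fun t h => by
    have := hre t
    simp [h] at this
  have hlog : Continuous fun t => Complex.log (circleMap c r t) :=
    (continuous_circleMap c r).clog fun t => Or.inl (hre t)
  have hfc : Continuous fun t => f (circleMap c r t) :=
    hf.comp_continuous (continuous_circleMap c r) fun t => circleMap_mem_sphere c hr.le t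
  have hd : Continuous fun t => deriv (circleMap c r) t := by
    simp only [deriv_circleMap]
    fun_prop
  have hpow : ∀ s : ℂ, Continuous fun t => circleMap c r t ^ (-s) := fun s => by
    simp only [fun t => Complex.cpow_def_of_ne_zero (hne t) (-s)]
    exact (hlog.mul continuous_const).cexp
  have key := (intervalIntegral.hasDerivAt_integral_of_dominated_loc_of_deriv_le
    (μ := MeasureTheory.volume) (a := 0) (b := 2 * Real.pi) (x₀ := (0 : ℂ))
    (F := fun s t => deriv (circleMap c r) t • circleMap c r t ^ (-s) • f (circleMap c r t))
    (F' := fun s t => deriv (circleMap c r) t • (circleMap c r t ^ (-s) *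
      Complex.log (circleMap c r t) * -1) • f (circleMap c r t))
    (bound := fun t => ‖deriv (circleMap c r) t‖ * (Real.exp ‖Complex.log (circleMap c r t)‖ *
      ‖Complex.log (circleMap c r t)‖ * ‖f (circleMap c r t)‖))
    (Metric.ball_mem_nhds 0 one_pos) ?_ ?_ ?_ ?_ ?_ ?_).2
  · simp only [circleIntegral]
    convert key using 1
    rw [← intervalIntegral.integral_neg]
    refine intervalIntegral.integral_congr fun t _ => ?_
    simp
  · exact Eventually.of_forall fun s =>
      (hd.smul ((hpow s).smul hfc)).aestronglyMeasurable
  · exact (hd.smul ((hpow 0).smul hfc)).intervalIntegrable _ _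
  · exact (hd.smul ((((hpow 0).mul hlog).mul continuous_const).smul hfc)).aestronglyMeasurable
  · refine Eventually.of_forall fun t _ s hs => ?_
    have hs1 : ‖s‖ ≤ 1 := (mem_ball_zero_iff.1 hs).le
    rw [norm_smul, norm_smul, norm_mul, norm_mul, norm_neg, norm_one, mul_one]
    gcongr
    rw [Complex.cpow_def_of_ne_zero (hne t)]
    refine (Complex.norm_exp_le_exp_norm _).trans (Real.exp_le_exp.2 ?_)
    rw [norm_mul, norm_neg]
    exact mul_le_of_le_one_right (norm_nonneg _) hs1
  · exact (hd.norm.mul (((Real.continuous_exp.comp hlog.norm).mul hlog.norm).mul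
      hfc.norm)).intervalIntegrable _ _
  · refine Eventually.of_forall fun t _ s _ => ?_
    exact (((hasDerivAt_id s).neg.const_cpow (Or.inl (hne t))).smul_const _).const_smul _

theorem spectrum_add_algebraMap_subset_ball {a : 𝔸} {z : ℂ} {r : ℝ} (hr : ‖a‖ * ‖(1 : 𝔸)‖ < r) :
    spectrum ℂ (a + algebraMap ℂ 𝔸 z) ⊆ Metric.ball z r := by
  intro w hw
  have h1 : w - z ∈ spectrum ℂ a := by
    rw [spectrum.mem_iff] at hw ⊢
    convert hw using 2
    rw [map_sub]
    abel
  have h2 := spectrum.subset_closedBall_norm_mul (𝕜 := ℂ) a h1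
  rw [mem_closedBall_zero_iff] at h2
  rw [Metric.mem_ball, dist_eq_norm]
  exact h2.trans_lt hr

/-- The complex powers of `a + z` are differentiable in the exponent, and the derivative is the
logarithm, which expands in powers of `a`. -/
theorem exists_hasDerivAt_holomorphicPower {a : 𝔸} {z : ℂ} (hz : ‖a‖ * ‖(1 : 𝔸)‖ < z.re) :
    ∃ L : 𝔸, HasDerivAt (fun s => holomorphicPower (a + algebraMap ℂ 𝔸 z) (-s)) (-L) 0 ∧
      Tendsto (fun n => algebraMap ℂ 𝔸 (Complex.log z) + ∑ k ∈ Finset.range n,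
        ((-1) ^ (k + 1) / (z ^ k * k) : ℂ) • a ^ k) atTop (𝓝 L) := by
  obtain ⟨r, hr, hrz⟩ := exists_between hz
  have hr0 : 0 < r := lt_of_le_of_lt (by positivity) hr
  set b := a + algebraMap ℂ 𝔸 z with hb
  have hspec : spectrum ℂ b ⊆ Metric.ball z r := spectrum_add_algebraMap_subset_ball hr
  have h : ∃ p : ℝ × ℝ, 0 < p.2 ∧ p.2 < p.1 ∧ spectrum ℂ b ⊆ Metric.ball (p.1 : ℂ) p.2 :=
    exists_ball_of_isCompact_of_re_pos (spectrum.isCompact b) fun w hw =>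
      re_pos_of_mem_closedBall hrz (Metric.ball_subset_closedBall (hspec hw))
  obtain ⟨h1, h2, h3⟩ := h.choose_spec
  have h2' : h.choose.2 < ((h.choose.1 : ℝ) : ℂ).re := by simpa using h2
  refine ⟨(2 * Real.pi * Complex.I : ℂ)⁻¹ • ∮ w in C((h.choose.1 : ℂ), h.choose.2),
    Complex.log w • resolvent b w, ?_, ?_⟩
  · simp only [holomorphicPower, dif_pos h]
    rw [← smul_neg]
    exact (hasDerivAt_circleIntegral_cpow_neg h1 h2'
      (continuousOn_resolvent_sphere h3)).const_smul (2 * Real.pi * Complex.I : ℂ)⁻¹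
  · refine (tendsto_aeval_logTaylor h1 h2' hr0 hrz h3 hspec).congr fun n => ?_
    simp [logTaylor, hb, Algebra.smul_def]

end Logarithm

/-! ### Sections over a set of representatives -/

section Representatives

universe u v w

variable (Γ : Type u) [Group Γ] {Y : Type v} [MulAction Γ Y] {F : Y → Type w}
  [∀ y, NormedAddCommGroup (F y)] [∀ y, InnerProductSpace ℂ (F y)]

theorem exists_eq_smul_out (x : Y) :
    ∃ (o : MulAction.orbitRel.Quotient Γ Y) (g : Γ), x = g • o.out := by
  obtain ⟨g, hg⟩ : (Quotient.mk'' x : MulAction.orbitRel.Quotient Γ Y).out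
      ∈ MulAction.orbit Γ x :=
    MulAction.orbitRel_apply.1 (Quotient.mk_out (s := MulAction.orbitRel Γ Y) x)
  refine ⟨Quotient.mk'' x, g⁻¹, ?_⟩
  rw [← hg]
  simp

variable {Γ}

theorem eq_and_eq_one_of_smul_out_eq_out [IsCancelSMul Γ Y] {g : Γ}
    {o o' : MulAction.orbitRel.Quotient Γ Y} (h : g • o.out = o'.out) : o = o' ∧ g = 1 := by
  have ho : o = o' := by
    rw [← Quotient.out_eq o, ← Quotient.out_eq o']
    exact (Quotient.sound (s := MulAction.orbitRel Γ Y)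
      (MulAction.orbitRel_apply.2 ⟨g, h⟩)).symm
  subst ho
  exact ⟨rfl, IsCancelSMul.right_cancel g 1 o.out (by rw [h, one_smul])⟩

theorem extendByZero_apply [Finite (MulAction.orbitRel.Quotient Γ Y)]
    [Fintype (MulAction.orbitRel.Quotient Γ Y)] [hY : DecidableEq Y]
    (v : ∀ o : MulAction.orbitRel.Quotient Γ Y, F o.out) (y : Y) :
    extendByZero Γ v y = ∑ o, (lp.single 2 o.out (v o) : L2 F) y := by
  obtain rfl : hY = fun a b => Classical.propDecidable (a = b) := Subsingleton.elim _ _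
  rw [extendByZero, LinearMap.sum_apply, lp.coeFn_sum, Finset.sum_apply]
  convert! rfl

theorem extendByZero_apply_out [Finite (MulAction.orbitRel.Quotient Γ Y)]
    (v : ∀ o : MulAction.orbitRel.Quotient Γ Y, F o.out) (o : MulAction.orbitRel.Quotient Γ Y) :
    extendByZero Γ v o.out = v o := by
  classical
  have := Fintype.ofFinite (MulAction.orbitRel.Quotient Γ Y)
  rw [extendByZero_apply, Finset.sum_eq_single o]
  · exact lp.single_apply_self _ _ _
  · intro o' _ ho
    exact lp.single_apply_ne _ _ _ fun h => ho (Quotient.out_injective h.symm)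
  · simp

theorem extendByZero_apply_eq_zero [Finite (MulAction.orbitRel.Quotient Γ Y)]
    (v : ∀ o : MulAction.orbitRel.Quotient Γ Y, F o.out) {y : Y}
    (hy : ∀ o : MulAction.orbitRel.Quotient Γ Y, o.out ≠ y) : extendByZero Γ v y = 0 := by
  classical
  have := Fintype.ofFinite (MulAction.orbitRel.Quotient Γ Y)
  rw [extendByZero_apply]
  exact Finset.sum_eq_zero fun o _ => lp.single_apply_ne _ _ _ (hy o).symm

variable (Γ) in
/-- Extension by zero from the set of representatives, with values in the compactly supported
sections. -/
noncomputable def extendByZeroCompact [Finite (MulAction.orbitRel.Quotient Γ Y)] :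
    (∀ o : MulAction.orbitRel.Quotient Γ Y, F o.out) →ₗ[ℂ] CompactSections F where
  toFun v := ⟨⇑(extendByZero Γ v), by
    refine (Set.finite_range fun o : MulAction.orbitRel.Quotient Γ Y => o.out).subset fun y hy => ?_
    by_contra h
    exact hy (extendByZero_apply_eq_zero v fun o ho => h ⟨o, ho⟩)⟩
  map_add' v w := Subtype.ext (congrArg (fun f : L2 F => (⇑f : ∀ y, F y))
    (map_add (extendByZero Γ) v w))
  map_smul' c v := Subtype.ext (congrArg (fun f : L2 F => (⇑f : ∀ y, F y))
    (map_smul (extendByZero Γ) c v))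

theorem toL2_extendByZeroCompact [Finite (MulAction.orbitRel.Quotient Γ Y)]
    (v : ∀ o : MulAction.orbitRel.Quotient Γ Y, F o.out) :
    toL2 (extendByZeroCompact Γ v) = extendByZero Γ v := rfl

/-- Restriction of arbitrary sections to the set of representatives. -/
noncomputable def restrictOut :
    (∀ y, F y) →ₗ[ℂ] (∀ o : MulAction.orbitRel.Quotient Γ Y, F o.out) where
  toFun φ o := φ o.out
  map_add' _ _ := rfl
  map_smul' _ _ := rfl

/-- The trace `tr_Γ` is a continuous linear functional. -/
theorem exists_clm_eq_gammaTrace [Finite (MulAction.orbitRel.Quotient Γ Y)]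
    [∀ y, FiniteDimensional ℂ (F y)] :
    ∃ ℓ : (L2 F →L[ℂ] L2 F) →L[ℂ] ℂ, ∀ T, ℓ T = gammaTrace Γ T := by
  classical
  have := Fintype.ofFinite (MulAction.orbitRel.Quotient Γ Y)
  let V := ∀ o : MulAction.orbitRel.Quotient Γ Y, F o.out
  let b := Module.finBasis ℂ V
  let res : L2 F →L[ℂ] V := ContinuousLinearMap.pi fun o =>
    LinearMap.mkContinuous (LinearMap.proj o ∘ₗ restrictToReps Γ) 1 fun f => by
      rw [one_mul]
      exact lp.norm_apply_le_norm (by simp) f o.out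
  let co : ∀ i, V →L[ℂ] ℂ := fun i => LinearMap.toContinuousLinearMap (b.coord i)
  refine ⟨∑ i, ((co i).comp res).comp
    (ContinuousLinearMap.apply ℂ (L2 F) (extendByZero Γ (b i))), fun T => ?_⟩
  rw [gammaTrace, LinearMap.trace_eq_matrix_trace ℂ b, Matrix.trace, sum_apply]
  refine Finset.sum_congr rfl fun i _ => ?_
  rw [Matrix.diag_apply, LinearMap.toMatrix_apply]
  rfl

theorem gammaTrace_one [Finite (MulAction.orbitRel.Quotient Γ Y)] [∀ y, FiniteDimensional ℂ (F y)] :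
    gammaTrace Γ (1 : L2 F →L[ℂ] L2 F) =
      Module.finrank ℂ (∀ o : MulAction.orbitRel.Quotient Γ Y, F o.out) := by
  have := Fintype.ofFinite (MulAction.orbitRel.Quotient Γ Y)
  rw [gammaTrace, ← LinearMap.trace_id]
  congr 1
  ext1 v
  funext o
  exact extendByZero_apply_out v o

end Representatives

/-! ### Powers and pointwise estimates of invariant operators -/

section InvariantOperators

universe u v w

variable {Γ : Type u} [Group Γ] {Y : Type v} [MulAction Γ Y] {F : Y → Type w}
  [∀ y, NormedAddCommGroup (F y)] [∀ y, InnerProductSpace ℂ (F y)] (A : UnitaryLift Γ F)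
  [MetricSpace Y] [DiscreteTopology Y] [ProperSpace Y]
  {D : CompactSections F →ₗ[ℂ] (∀ y, F y)} (hD : IsGammaInvariant A D)
  (hR : HasFinitePropagationSpeed D)

include hD in
theorem compactEnd_pow_comp_actc (n : ℕ) (g : Γ) :
    (compactEnd D hR ^ n : Module.End ℂ (CompactSections F)) ∘ₗ actc A g =
      actc A g ∘ₗ (compactEnd D hR ^ n : Module.End ℂ (CompactSections F)) := by
  have h : Commute (compactEnd D hR : Module.End ℂ (CompactSections F)) (actc A g) :=
    LinearMap.ext fun φ => Subtype.ext (hD g φ)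
  exact (h.pow_left n).eq

section Pushdown

variable [IsCancelSMul Γ Y]

theorem pushdown_pow_comp_summation (H : Subgroup Γ) [Finite (MulAction.orbitRel.Quotient H Y)]
    (n : ℕ) :
    (pushdown A D hD hR H ^ n) ∘ₗ summation A H =
      summation A H ∘ₗ (compactEnd D hR ^ n : Module.End ℂ (CompactSections F)) := by
  induction n with
  | zero => rfl
  | succ n ih =>
    rw [pow_succ, pow_succ, Module.End.mul_eq_comp, Module.End.mul_eq_comp, LinearMap.comp_assoc,
      pushdown_comp_summation, ← LinearMap.comp_assoc, ih, LinearMap.comp_assoc]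

/-- The value at `y` of the pushdown of `D` is the value of `D` on a compactly supported section
that agrees with the given invariant section near `y`. -/
theorem exists_pushdown_apply_eq {R : ℝ} (hR' : HasPropagationSpeedLE D R) (H : Subgroup Γ)
    [Finite (MulAction.orbitRel.Quotient H Y)] (φ : InvariantSections A H) (y : Y) :
    ∃ χ : CompactSections F, (∀ z ∈ Metric.ball y R, χ.1 z = φ.1 z) ∧
      (pushdown A D hD hR H φ).1 y = D χ y := by
  classical
  obtain ⟨ψ, rfl⟩ := summation_surjective A H φ
  let E : Finset H := ((finite_ball y R).biUnion fun z _ => finite_act_ne_zero A H ψ z).toFinset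
  have hE : ∀ (g : H) (z : Y), z ∈ Metric.ball y R → act A (g : Γ)⁻¹ ψ.1 z ≠ 0 → g ∈ E := by
    intro g z hz h
    simp only [E, Set.Finite.mem_toFinset, Set.mem_iUnion]
    exact ⟨z, hz, h⟩
  refine ⟨∑ g ∈ E, actc A (g : Γ)⁻¹ ψ, fun z hz => ?_, ?_⟩
  · rw [summation_apply, finsum_eq_sum_of_support_subset (s := E) _ fun g hg => hE g z hz hg,
      Submodule.coe_sum, Finset.sum_apply]
    rfl
  · rw [← LinearMap.comp_apply, pushdown_comp_summation, LinearMap.comp_apply, summation_apply,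
      map_sum, Finset.sum_apply]
    have hc : ∀ g : H, act A (g : Γ)⁻¹ (compactEnd D hR ψ).1 y = D (actc A (g : Γ)⁻¹ ψ) y :=
      fun g => (congrFun (hD (g : Γ)⁻¹ ψ) y).symm
    simp_rw [hc]
    refine finsum_eq_sum_of_support_subset (s := E) _ fun g hg => ?_
    obtain ⟨z, hz, hyz⟩ := Metric.mem_thickening_iff.1 (hR' _ hg)
    exact hE g z (by rwa [Metric.mem_ball, dist_comm]) hz

end Pushdown

variable [Finite (MulAction.orbitRel.Quotient Γ Y)] [∀ y, FiniteDimensional ℂ (F y)]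
  [IsIsometricSMul Γ Y]

include hD in
theorem l2Extension_pow_toL2 (n : ℕ) (φ : CompactSections F) :
    (l2Extension D hR ^ n) (toL2 φ) =
      toL2 ((compactEnd D hR ^ n : Module.End ℂ (CompactSections F)) φ) := by
  induction n generalizing φ with
  | zero => rfl
  | succ n ih =>
    rw [pow_succ, pow_succ, mul_apply_eq_comp, l2Extension_toL2 A hD hR, ih]
    rfl

include hD in
theorem gammaTrace_l2Extension_pow (n : ℕ) :
    gammaTrace Γ (l2Extension D hR ^ n) =
      LinearMap.trace ℂ (∀ o : MulAction.orbitRel.Quotient Γ Y, F o.out)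
        (restrictOut ∘ₗ (CompactSections F).subtype ∘ₗ
          (compactEnd D hR ^ n : Module.End ℂ (CompactSections F)) ∘ₗ extendByZeroCompact Γ) := by
  rw [gammaTrace]
  congr 1
  ext1 v
  simp only [LinearMap.comp_apply, ContinuousLinearMap.coe_coe]
  rw [← toL2_extendByZeroCompact, l2Extension_pow_toL2 A hD hR]
  rfl

include hD in
/-- An invariant operator of finite propagation speed is bounded for the supremum norm. -/
theorem exists_sup_bound {R : ℝ} (hR' : HasPropagationSpeedLE D R) :
    ∃ K : ℝ, 0 ≤ K ∧ ∀ (φ : CompactSections F) (y : Y) (B : ℝ), 0 ≤ B →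
      (∀ z ∈ Metric.ball y R, ‖φ.1 z‖ ≤ B) → ‖D φ y‖ ≤ K * B := by
  have := Fintype.ofFinite (MulAction.orbitRel.Quotient Γ Y)
  choose m hm0 hm using fun x => local_bound hR' x
  let k : MulAction.orbitRel.Quotient Γ Y → ℝ := fun o =>
    m o.out * ((finite_ball o.out R).toFinset.card : ℝ)
  have hk : ∀ o, 0 ≤ k o := fun o => mul_nonneg (hm0 _) (Nat.cast_nonneg _)
  have hk' : 0 ≤ ∑ o, k o := Finset.sum_nonneg fun o _ => hk o
  refine ⟨Real.sqrt (∑ o, k o), Real.sqrt_nonneg _, fun φ y B hB h => ?_⟩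
  obtain ⟨o, g, rfl⟩ := exists_eq_smul_out Γ y
  refine le_of_sq_le_sq ?_ (mul_nonneg (Real.sqrt_nonneg _) hB)
  rw [mul_pow, Real.sq_sqrt hk', ← norm_act_inv A, ← hD]
  refine (hm o.out (actc A g⁻¹ φ)).trans ?_
  calc m o.out * ∑ z ∈ (finite_ball o.out R).toFinset, ‖(actc A g⁻¹ φ).1 z‖ ^ 2
      ≤ m o.out * ∑ z ∈ (finite_ball o.out R).toFinset, B ^ 2 := by
        refine mul_le_mul_of_nonneg_left (Finset.sum_le_sum fun z hz => ?_) (hm0 _)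
        have h1 : ‖(actc A g⁻¹ φ).1 z‖ = ‖φ.1 (g • z)‖ := norm_act_inv A g φ.1 z
        rw [h1]
        refine pow_le_pow_left₀ (norm_nonneg _) (h _ ?_) 2
        rw [Set.Finite.mem_toFinset] at hz
        rwa [Metric.mem_ball, dist_smul]
    _ = k o * B ^ 2 := by
        rw [Finset.sum_const, nsmul_eq_mul, mul_assoc]
    _ ≤ (∑ o, k o) * B ^ 2 :=
        mul_le_mul_of_nonneg_right (Finset.single_le_sum (fun o _ => hk o) (Finset.mem_univ o))
          (sq_nonneg B)

end InvariantOperators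

/-! ### Traces of pushdowns -/

section PushdownTrace

universe u v w

variable {Γ : Type u} [Group Γ] {Y : Type v} [MulAction Γ Y] {F : Y → Type w}
  [∀ y, NormedAddCommGroup (F y)] [∀ y, InnerProductSpace ℂ (F y)] (A : UnitaryLift Γ F)

theorem act_inv_act (g : Γ) (φ : ∀ y, F y) : act A g⁻¹ (act A g φ) = φ := by
  rw [← act_mul, inv_mul_cancel, act_one]

theorem act_act_inv (g : Γ) (φ : ∀ y, F y) : act A g (act A g⁻¹ φ) = φ := by
  rw [← act_mul, mul_inv_cancel, act_one]

/-- Summation over a normal subgroup `H` commutes with the action of all of `Γ`. -/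
theorem summation_actc [IsCancelSMul Γ Y] (H : Subgroup Γ) [H.Normal] (g : Γ)
    (φ : CompactSections F) :
    (summation A H (actc A g φ)).1 = act A g (summation A H φ).1 := by
  funext x
  obtain ⟨y, rfl⟩ : ∃ y, x = g • y := ⟨g⁻¹ • x, by simp⟩
  rw [act_smul, summation_apply, summation_apply, map_finsum (A.map g y)
    (finite_act_ne_zero A H φ y), ← finsum_comp_equiv (MulAut.conjNormal g : H ≃* H).toEquiv]
  refine finsum_congr fun h => ?_
  rw [← act_smul, ← act_mul]
  change act A _ (act A g φ.1) (g • y) = _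
  rw [← act_mul]
  simp [MulAut.conjNormal_apply, mul_assoc]

variable [IsCancelSMul Γ Y] [Finite (MulAction.orbitRel.Quotient Γ Y)]

/-- The sections over the set of representatives, moved by `g` and summed over `H`. -/
noncomputable def insertAt (H : Subgroup Γ) (g : Γ) :
    (∀ o : MulAction.orbitRel.Quotient Γ Y, F o.out) →ₗ[ℂ] InvariantSections A H :=
  summation A H ∘ₗ actc A g ∘ₗ extendByZeroCompact Γ

/-- The restriction of an `H`-invariant section to the `g`-translate of the set of
representatives. -/
noncomputable def restrictAt (H : Subgroup Γ) (g : Γ) :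
    InvariantSections A H →ₗ[ℂ] (∀ o : MulAction.orbitRel.Quotient Γ Y, F o.out) :=
  restrictOut ∘ₗ act A g⁻¹ ∘ₗ (InvariantSections A H).subtype

/-- The compression to the set of representatives of `S ∘ E`. -/
noncomputable def compression (H : Subgroup Γ) (E : Module.End ℂ (CompactSections F)) :
    Module.End ℂ (∀ o : MulAction.orbitRel.Quotient Γ Y, F o.out) :=
  restrictOut ∘ₗ (InvariantSections A H).subtype ∘ₗ summation A H ∘ₗ E ∘ₗ extendByZeroCompact Γ

/-- The translates of the set of representatives by coset representatives of `H` form a set of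
representatives for `H`, which decomposes the identity. -/
theorem sum_insertAt_comp_restrictAt (H : Subgroup Γ) [H.Normal] [Fintype (Γ ⧸ H)] :
    ∑ q : Γ ⧸ H, insertAt A H q.out ∘ₗ restrictAt A H q.out = LinearMap.id := by
  classical
  ext ψ x
  obtain ⟨o, g, rfl⟩ := exists_eq_smul_out Γ x
  rw [LinearMap.sum_apply, Submodule.coe_sum, Finset.sum_apply, LinearMap.id_apply]
  simp only [LinearMap.comp_apply]
  set χ : Γ ⧸ H → (∀ y, F y) := fun q =>
    act A q.out (extendByZeroCompact Γ (restrictAt A H q.out ψ)).1 with hχ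
  have happly : ∀ q : Γ ⧸ H, (insertAt A H q.out (restrictAt A H q.out ψ)).1 (g • o.out) =
      ∑ᶠ h : H, act A (h : Γ)⁻¹ (χ q) (g • o.out) := fun q => rfl
  simp only [happly]
  have hzero : ∀ (q : Γ ⧸ H) (h : H), (h : Γ) * g ≠ q.out →
      act A (h : Γ)⁻¹ (χ q) (g • o.out) = 0 := by
    intro q h hne
    rw [act_eq_zero_iff, hχ]
    have h1 := act_eq_zero_iff A (q.out)⁻¹
      (extendByZeroCompact Γ (restrictAt A H q.out ψ)).1 ((h : Γ) • g • o.out)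
    rw [inv_inv] at h1
    refine h1.2 (extendByZero_apply_eq_zero _ fun o' ho' => hne ?_)
    rw [← mul_smul, ← mul_smul] at ho'
    have h2 := (eq_and_eq_one_of_smul_out_eq_out ho'.symm).2
    rw [mul_assoc, inv_mul_eq_one] at h2
    exact h2.symm
  -- the orbit `H g • o.out` meets the chosen representatives only in the translate by the
  -- representative of the coset of `g`; left and right cosets agree as `H` is normal
  set q₀ : Γ ⧸ H := (g : Γ ⧸ H) with hq₀
  have hmem : q₀.out * g⁻¹ ∈ H := by
    have h1 : g⁻¹ * q₀.out ∈ H := QuotientGroup.eq.1 (QuotientGroup.out_eq' q₀).symm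
    exact (inferInstance : H.Normal).mem_comm h1
  rw [Finset.sum_eq_single q₀, finsum_eq_single _ (⟨q₀.out * g⁻¹, hmem⟩ : H)]
  · have h1 : χ q₀ ((q₀.out * g⁻¹) • g • o.out) = ψ.1 ((q₀.out * g⁻¹) • g • o.out) := by
      rw [← mul_smul, inv_mul_cancel_right, hχ]
      simp only
      rw [act_smul]
      have h2 : (extendByZeroCompact Γ (restrictAt A H q₀.out ψ)).1 o.out
          = act A (q₀.out)⁻¹ ψ.1 o.out := extendByZero_apply_out _ o
      rw [h2, ← act_smul, act_act_inv]
    rw [act_inv_congr A (q₀.out * g⁻¹) h1, ψ.2 _ (inv_mem hmem)]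
  · intro h hh
    refine hzero _ _ fun h1 => hh (Subtype.ext ?_)
    simp [← h1]
  · intro q _ hq
    refine finsum_eq_zero_of_forall_eq_zero fun h => hzero _ _ fun h1 => hq ?_
    rw [← QuotientGroup.out_eq' q, hq₀, ← h1, QuotientGroup.eq]
    have h2 := (inferInstance : H.Normal).conj_mem _ (inv_mem h.2) g⁻¹
    simpa [mul_assoc] using h2
  · simp

/-- For a fixed compactly supported section, only the unit element of `H` contributes to the sum
over `H` on the set of representatives once `H` is deep enough in the tower. -/
theorem eventually_summation_out_eq (Λ : Tower Γ) (φ : CompactSections F) :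
    ∀ᶠ j in atTop, ∀ o : MulAction.orbitRel.Quotient Γ Y,
      (summation A (Λ.subgroup j) φ).1 o.out = φ.1 o.out := by
  refine eventually_all.2 fun o => ?_
  have hfin : {g : Γ | φ.1 (g • o.out) ≠ 0}.Finite :=
    φ.2.preimage (f := fun g : Γ => g • o.out)
      fun a _ b _ h => IsCancelSMul.right_cancel _ _ _ h
  have hev : ∀ᶠ j in atTop, ∀ g ∈ {g : Γ | φ.1 (g • o.out) ≠ 0}, g ∈ Λ.subgroup j → g = 1 := by
    refine (eventually_all_finite hfin).2 fun g _ => ?_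
    by_cases hg : g = 1
    · exact Eventually.of_forall fun j _ => hg
    · have h1 : g ∉ ⨅ j, Λ.subgroup j := by rwa [Λ.iInf_eq, Subgroup.mem_bot]
      rw [Subgroup.mem_iInf, not_forall] at h1
      obtain ⟨J, hJ⟩ := h1
      filter_upwards [eventually_ge_atTop J] with j hj hgj
      exact absurd (Λ.antitone hj hgj) hJ
  filter_upwards [hev] with j hj
  rw [summation_apply, finsum_eq_single _ 1]
  · rw [Subgroup.coe_one, inv_one, act_one]
  · intro g hg
    rw [act_eq_zero_iff]
    by_contra h
    exact hg (Subtype.ext (hj g h g.2))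

variable [∀ y, FiniteDimensional ℂ (F y)]

/-- The trace of an operator on the quotient sheaf that is induced by a `Γ`-invariant operator `E`:
each of the `[Γ : H]` translates of the set of representatives contributes the same amount. -/
theorem trace_eq_index_mul_trace_compression (H : Subgroup Γ) [H.Normal] [H.FiniteIndex]
    [Finite (MulAction.orbitRel.Quotient H Y)]
    (E : Module.End ℂ (CompactSections F)) (hE : ∀ g, E ∘ₗ actc A g = actc A g ∘ₗ E)
    (P : Module.End ℂ (InvariantSections A H)) (hP : P ∘ₗ summation A H = summation A H ∘ₗ E) :
    LinearMap.trace ℂ _ P = H.index * LinearMap.trace ℂ _ (compression A H E) := by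
  classical
  have := Fintype.ofFinite (Γ ⧸ H)
  have := Fintype.ofFinite (MulAction.orbitRel.Quotient Γ Y)
  have hcomp : ∀ g, restrictAt A H g ∘ₗ P ∘ₗ insertAt A H g = compression A H E := by
    intro g
    refine LinearMap.ext fun v => ?_
    have h1 : P (summation A H (actc A g (extendByZeroCompact Γ v))) =
        summation A H (actc A g (E (extendByZeroCompact Γ v))) := by
      rw [← LinearMap.comp_apply P, hP, LinearMap.comp_apply, ← LinearMap.comp_apply E, hE]
      rfl
    change restrictOut (act A g⁻¹ (P (summation A H (actc A g (extendByZeroCompact Γ v)))).1) = _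
    rw [h1, summation_actc, act_inv_act]
    rfl
  calc LinearMap.trace ℂ _ P
      = LinearMap.trace ℂ _ (P ∘ₗ ∑ q : Γ ⧸ H, insertAt A H q.out ∘ₗ restrictAt A H q.out) := by
        rw [sum_insertAt_comp_restrictAt, LinearMap.comp_id]
    _ = ∑ q : Γ ⧸ H, LinearMap.trace ℂ _ ((P ∘ₗ insertAt A H q.out) ∘ₗ restrictAt A H q.out) := by
        rw [← map_sum]
        congr 1
        ext1 φ
        simp only [LinearMap.comp_apply, LinearMap.sum_apply, map_sum]
    _ = ∑ _q : Γ ⧸ H, LinearMap.trace ℂ _ (compression A H E) := by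
        refine Finset.sum_congr rfl fun q _ => ?_
        rw [LinearMap.trace_comp_comm', hcomp]
    _ = _ := by
        rw [Finset.sum_const, Finset.card_univ, nsmul_eq_mul, Subgroup.index,
          Nat.card_eq_fintype_card]

theorem eventually_compression_eq (Λ : Tower Γ) (E : Module.End ℂ (CompactSections F)) :
    ∀ᶠ j in atTop, compression A (Λ.subgroup j) E =
      restrictOut ∘ₗ (CompactSections F).subtype ∘ₗ E ∘ₗ extendByZeroCompact Γ := by
  classical
  have := Fintype.ofFinite (MulAction.orbitRel.Quotient Γ Y)
  let b := Module.finBasis ℂ (∀ o : MulAction.orbitRel.Quotient Γ Y, F o.out)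
  filter_upwards [eventually_all.2 fun i => eventually_summation_out_eq A Λ
    (E (extendByZeroCompact Γ (b i)))] with j hj
  exact b.ext fun i => funext fun o => hj i o

/-- The trace formula for the identity; here the compression is the identity for every `H`, since no
nontrivial element of `Γ` maps a representative to a representative. -/
theorem finrank_invariantSections (H : Subgroup Γ) [H.Normal] [H.FiniteIndex]
    [Finite (MulAction.orbitRel.Quotient H Y)] :
    Module.finrank ℂ (InvariantSections A H) =
      H.index * Module.finrank ℂ (∀ o : MulAction.orbitRel.Quotient Γ Y, F o.out) := by
  have := Fintype.ofFinite (MulAction.orbitRel.Quotient Γ Y)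
  have h := trace_eq_index_mul_trace_compression A H LinearMap.id (fun g => rfl) LinearMap.id rfl
  have hid : compression A H (LinearMap.id : Module.End ℂ (CompactSections F)) =
      LinearMap.id := by
    ext1 v
    funext o
    change (summation A H (extendByZeroCompact Γ v)).1 o.out = v o
    rw [summation_apply, finsum_eq_single _ 1]
    · rw [Subgroup.coe_one, inv_one, act_one]
      exact extendByZero_apply_out v o
    · intro g hg
      rw [act_eq_zero_iff]
      refine extendByZero_apply_eq_zero v fun o' ho' => hg (Subtype.ext ?_)
      exact (eq_and_eq_one_of_smul_out_eq_out ho'.symm).2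
  rw [hid, LinearMap.trace_id, LinearMap.trace_id] at h
  exact_mod_cast h

variable [MetricSpace Y] [DiscreteTopology Y] [ProperSpace Y] [IsIsometricSMul Γ Y]
  {D : CompactSections F →ₗ[ℂ] (∀ y, F y)} (hD : IsGammaInvariant A D)
  (hR : HasFinitePropagationSpeed D)

/-- The normalized moments of the pushdowns are eventually equal to the moments of `D` on the square
integrable sections. -/
theorem eventually_trace_pushdown_pow (Λ : Tower Γ) (n : ℕ) :
    ∀ᶠ j in atTop, ((Λ.subgroup j).index : ℂ)⁻¹ *
      LinearMap.trace ℂ _ (pushdown A D hD hR (Λ.subgroup j) ^ n) =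
        gammaTrace Γ (l2Extension D hR ^ n) := by
  filter_upwards [eventually_compression_eq A Λ (compactEnd D hR ^ n)] with j hj
  have := Λ.normal j
  rw [trace_eq_index_mul_trace_compression A (Λ.subgroup j) _
    (compactEnd_pow_comp_actc A hD hR n) _ (pushdown_pow_comp_summation A hD hR _ n), hj,
    gammaTrace_l2Extension_pow A hD hR, inv_mul_cancel_left₀]
  exact Nat.cast_ne_zero.2 Subgroup.FiniteIndex.index_ne_zero

/-! ### A common bound for the characteristic roots of all pushdowns -/

/-- At a point where an eigensection attains its largest norm, the supremum bound for `D` bounds the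
eigenvalue. -/
theorem exists_bound_roots_charpoly_pushdown :
    ∃ M : ℝ, 0 ≤ M ∧ ∀ (H : Subgroup Γ) [Finite (MulAction.orbitRel.Quotient H Y)],
      ∀ μ ∈ (pushdown A D hD hR H).charpoly.roots, ‖μ‖ ≤ M := by
  obtain ⟨R, -, hR'⟩ := id hR
  obtain ⟨K, hK0, hK⟩ := exists_sup_bound A hD hR'
  refine ⟨K, hK0, fun H _ μ hμ => ?_⟩
  obtain ⟨φ, hφ⟩ := ((Module.End.hasEigenvalue_iff_isRoot_charpoly _ _).2
    (Polynomial.isRoot_of_mem_roots hμ)).exists_hasEigenvector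
  obtain ⟨y₀, hy₀⟩ : ∃ y, φ.1 y ≠ 0 := by
    by_contra! h
    exact hφ.2 (Subtype.ext (funext h))
  -- the norm of an invariant section is constant on orbits, so it attains its supremum
  have hnorm : ∀ x : Y, ∃ o : MulAction.orbitRel.Quotient H Y, ‖φ.1 x‖ = ‖φ.1 o.out‖ := by
    intro x
    obtain ⟨o, g, hg⟩ := exists_eq_smul_out H x
    refine ⟨o, ?_⟩
    have h1 : x = (g : Γ) • o.out := hg
    rw [h1, ← norm_act_inv A (g : Γ), φ.2 _ (inv_mem g.2)]
  obtain ⟨o₀, -⟩ := hnorm y₀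
  have : Nonempty (MulAction.orbitRel.Quotient H Y) := ⟨o₀⟩
  obtain ⟨o, ho⟩ := Finite.exists_max fun o : MulAction.orbitRel.Quotient H Y => ‖φ.1 o.out‖
  have hmax : ∀ x, ‖φ.1 x‖ ≤ ‖φ.1 o.out‖ := fun x => by
    obtain ⟨o', ho'⟩ := hnorm x
    exact ho' ▸ ho o'
  have hpos : 0 < ‖φ.1 o.out‖ := (norm_pos_iff.2 hy₀).trans_le (hmax y₀)
  obtain ⟨χ, hχ, hχD⟩ := exists_pushdown_apply_eq A hD hR hR' H φ o.out
  rw [hφ.apply_eq_smul] at hχD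
  have h1 := hK χ o.out _ hpos.le fun z hz => (hχ z hz).symm ▸ hmax z
  rw [← hχD] at h1
  change ‖μ • φ.1 o.out‖ ≤ _ at h1
  rw [norm_smul] at h1
  exact le_of_mul_le_mul_right h1 hpos

end PushdownTrace

/-! ### The `L²`-determinant near infinity -/

section GammaDeterminant

variable {Γ : Type*} [Group Γ] {Y : Type*} [MulAction Γ Y] {F : Y → Type*}
  [∀ y, NormedAddCommGroup (F y)] [∀ y, InnerProductSpace ℂ (F y)]
  [∀ y, FiniteDimensional ℂ (F y)]

theorem norm_mul_norm_one_lt {a : L2 F →L[ℂ] L2 F} {z : ℂ} (hz : ‖a‖ < z.re) :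
    ‖a‖ * ‖(1 : L2 F →L[ℂ] L2 F)‖ < z.re :=
  (mul_le_of_le_one_right (norm_nonneg _) ContinuousLinearMap.norm_id_le).trans_lt hz

theorem re_pos_of_mem_spectrum_add_algebraMap {a : L2 F →L[ℂ] L2 F} {z : ℂ} (hz : ‖a‖ < z.re)
    {w : ℂ} (hw : w ∈ spectrum ℂ (a + algebraMap ℂ (L2 F →L[ℂ] L2 F) z)) : 0 < w.re := by
  obtain ⟨r, hr, hrz⟩ := exists_between (norm_mul_norm_one_lt hz)
  exact re_pos_of_mem_closedBall hrz
    (Metric.ball_subset_closedBall (spectrum_add_algebraMap_subset_ball hr hw))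

variable [Finite (MulAction.orbitRel.Quotient Γ Y)]

variable (Γ) in
/-- The derivative of the zeta function of `a + z` at `0`, expanded in the moments
`tr_Γ (a ^ n)`. -/
theorem exists_hasDerivAt_gammaZeta {a : L2 F →L[ℂ] L2 F} {z : ℂ} (hz : ‖a‖ < z.re) :
    ∃ l : ℂ, HasDerivAt (gammaZeta Γ (a + algebraMap ℂ (L2 F →L[ℂ] L2 F) z)) (-l) 0 ∧
      Tendsto (fun n => Complex.log z *
        Module.finrank ℂ (∀ o : MulAction.orbitRel.Quotient Γ Y, F o.out) +
        ∑ k ∈ Finset.range n, (-1) ^ (k + 1) * (gammaTrace Γ (a ^ k) / z ^ k) / k) atTop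
        (𝓝 l) := by
  obtain ⟨ℓ, hℓ⟩ := exists_clm_eq_gammaTrace (Γ := Γ) (F := F)
  obtain ⟨L, hL, hlim⟩ := exists_hasDerivAt_holomorphicPower (norm_mul_norm_one_lt hz)
  refine ⟨ℓ L, ?_, ?_⟩
  · have h1 := ℓ.hasFDerivAt.comp_hasDerivAt (0 : ℂ) hL
    rw [map_neg] at h1
    refine h1.congr_deriv rfl |>.congr_of_eventuallyEq (Eventually.of_forall fun s => ?_)
    exact (hℓ _).symm
  · refine ((ℓ.continuous.tendsto L).comp hlim).congr fun n => ?_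
    simp only [Function.comp_apply, map_add, map_sum, map_smul, Algebra.algebraMap_eq_smul_one]
    simp only [hℓ, gammaTrace_one, smul_eq_mul]
    congr 1
    refine Finset.sum_congr rfl fun k _ => ?_
    ring

theorem gammaDet_eq {a : L2 F →L[ℂ] L2 F} {z : ℂ} (hz : ‖a‖ < z.re)
    (hs : Summable fun n : ℕ => (-1) ^ (n + 1) * (gammaTrace Γ (a ^ n) / z ^ n) / n) :
    gammaDet Γ (a + algebraMap ℂ (L2 F →L[ℂ] L2 F) z) =
      z ^ Module.finrank ℂ (∀ o : MulAction.orbitRel.Quotient Γ Y, F o.out) *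
        Complex.exp (∑' n : ℕ, (-1) ^ (n + 1) * (gammaTrace Γ (a ^ n) / z ^ n) / n) := by
  obtain ⟨l, hl, hlim⟩ := exists_hasDerivAt_gammaZeta Γ hz
  have hz0 : z ≠ 0 := fun h => by
    rw [h, Complex.zero_re] at hz
    exact absurd hz (not_lt.2 (norm_nonneg a))
  rw [gammaDet, hl.deriv, neg_neg,
    tendsto_nhds_unique hlim (hs.hasSum.tendsto_sum_nat.const_add _), Complex.exp_add, mul_comm
    (Complex.log z), Complex.exp_nat_mul, Complex.exp_log hz0]

end GammaDeterminant

/-! ### Convergence of the standard roots -/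

theorem mainTheorem2 {Γ : Type*} [Group Γ] {Y : Type*} [MetricSpace Y] [DiscreteTopology Y]
    [ProperSpace Y] [MulAction Γ Y] [IsIsometricSMul Γ Y] [IsCancelSMul Γ Y]
    [Finite (MulAction.orbitRel.Quotient Γ Y)]
    (F : Y → Type*) [∀ y, NormedAddCommGroup (F y)] [∀ y, InnerProductSpace ℂ (F y)]
    [∀ y, FiniteDimensional ℂ (F y)] (r : ℕ) (_hr : ∀ y, Module.finrank ℂ (F y) = r)
    (A : UnitaryLift Γ F)
    (D : CompactSections F →ₗ[ℂ] (∀ y, F y)) (hD : IsGammaInvariant A D)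
    (hR : HasFinitePropagationSpeed D) (Λ : Tower Γ) :
    ∃ C : ℝ,
      -- the `L²`-determinant is well defined on the half-plane `Re z > C`
      (∀ z ∈ halfPlane C,
        (∀ w ∈ spectrum ℂ (l2Extension D hR + algebraMap ℂ (L2 F →L[ℂ] L2 F) z), 0 < w.re) ∧
        DifferentiableAt ℂ
          (gammaZeta Γ (l2Extension D hR + algebraMap ℂ (L2 F →L[ℂ] L2 F) z)) 0) ∧
      -- the determinants do not vanish there and have standard roots
      (∀ j : ℕ,
        (∀ z ∈ halfPlane C, LinearMap.det (pushdown A D hD hR (Λ.subgroup j) +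
          algebraMap ℂ (Module.End ℂ (InvariantSections A (Λ.subgroup j))) z) ≠ 0) ∧
        ∃ f : ℂ → ℂ, IsStandardRoot (pushdown A D hD hR (Λ.subgroup j))
          (Λ.subgroup j).index C f) ∧
      -- the standard roots converge locally uniformly to the `L²`-determinant
      ∀ f : ℕ → ℂ → ℂ,
        (∀ j : ℕ, IsStandardRoot (pushdown A D hD hR (Λ.subgroup j))
          (Λ.subgroup j).index C (f j)) →
        TendstoLocallyUniformlyOn f
          (fun z => gammaDet Γ (l2Extension D hR + algebraMap ℂ (L2 F →L[ℂ] L2 F) z))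
          atTop (halfPlane C) := by
  obtain ⟨M, hM, hroots⟩ := exists_bound_roots_charpoly_pushdown A hD hR
  set a := l2Extension D hR
  -- `C > M` serves the finite levels, `C > ‖a‖` the functional calculus of `a + z`
  set C : ℝ := M + ‖a‖ + 1
  have hMC : M < C := by linarith [norm_nonneg a]
  have haC : ‖a‖ < C := by linarith
  have hC0 : 0 ≤ C := hM.trans hMC.le
  set P := fun j => pushdown A D hD hR (Λ.subgroup j)
  set d := Module.finrank ℂ (∀ o : MulAction.orbitRel.Quotient Γ Y, F o.out)
  have hN : ∀ j, (Λ.subgroup j).index ≠ 0 := fun j => Subgroup.FiniteIndex.index_ne_zero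
  have hrP : ∀ j, ∀ μ ∈ (P j).charpoly.roots, ‖μ‖ ≤ M := fun j => hroots (Λ.subgroup j)
  have hfin : ∀ j, Module.finrank ℂ (InvariantSections A (Λ.subgroup j)) =
      (Λ.subgroup j).index * d := fun j =>
    haveI := Λ.normal j
    finrank_invariantSections A (Λ.subgroup j)
  have hdet : ∀ j, ∀ z ∈ halfPlane C, LinearMap.det (P j +
      algebraMap ℂ (Module.End ℂ (InvariantSections A (Λ.subgroup j))) z) ≠ 0 := fun j z hz =>
    det_add_algebraMap_ne_zero fun μ hμ =>
      ((hrP j μ hμ).trans_lt hMC).trans (lt_norm_of_mem_halfPlane hz)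
  have hstd : ∀ j, IsStandardRoot (P j) (Λ.subgroup j).index C
      (standardRoot (P j) (Λ.subgroup j).index d) := fun j =>
    isStandardRoot_standardRoot (hN j) (hfin j) hC0 fun μ hμ => (hrP j μ hμ).trans hMC.le
  refine ⟨C, fun z hz => ⟨fun w hw => re_pos_of_mem_spectrum_add_algebraMap (haC.trans hz) hw, ?_⟩,
    fun j => ⟨hdet j, _, hstd j⟩, fun f hf => ?_⟩
  · obtain ⟨l, hl, -⟩ := exists_hasDerivAt_gammaZeta Γ (haC.trans hz)
    exact hl.differentiableAt
  -- the normalized moments of the pushdowns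
  set c : ℕ → ℕ → ℂ := fun j n => ((Λ.subgroup j).index : ℂ)⁻¹ * LinearMap.trace ℂ _ (P j ^ n)
    with hc
  have hcM : ∀ j n, ‖c j n‖ ≤ d * M ^ n := by
    intro j n
    have hN' : (0 : ℝ) < (Λ.subgroup j).index := by exact_mod_cast Nat.pos_of_ne_zero (hN j)
    have h1 : ‖((P j).charpoly.roots.map fun μ => μ ^ n).sum‖ ≤
        (P j).charpoly.roots.card • M ^ n := by
      refine (norm_multiset_sum_le _).trans ?_
      rw [Multiset.map_map, ← Multiset.card_map (fun μ => ‖μ ^ n‖)]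
      refine Multiset.sum_le_card_nsmul _ _ fun x hx => ?_
      obtain ⟨μ, hμ, rfl⟩ := Multiset.mem_map.1 hx
      rw [Function.comp_apply, norm_pow]
      gcongr
      exact hrP j μ hμ
    rw [card_roots_charpoly, hfin j, nsmul_eq_mul, Nat.cast_mul] at h1
    simp only [hc]
    rw [trace_pow_eq_sum_roots, norm_mul, norm_inv, RCLike.norm_natCast, inv_mul_le_iff₀ hN']
    linarith
  have hconv := tendstoUniformlyOn_log_series hM hMC hcM
    (eventually_trace_pushdown_pow A hD hR Λ)
  have hcM' : ∀ n, ‖gammaTrace Γ (a ^ n)‖ ≤ d * M ^ n := fun n => by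
    obtain ⟨j, hj⟩ := (eventually_trace_pushdown_pow A hD hR Λ n).exists
    exact hj ▸ hcM j n
  have hsub : halfPlane C ⊆ {z | C ≤ ‖z‖} := fun z hz => (lt_norm_of_mem_halfPlane hz).le
  set g : ℂ → ℂ := fun z => ∑' n : ℕ, (-1) ^ (n + 1) * (gammaTrace Γ (a ^ n) / z ^ n) / n
  set gj : ℕ → ℂ → ℂ := fun j z => ∑' n : ℕ, (-1) ^ (n + 1) * (c j n / z ^ n) / n
  have hgj_eq : ∀ j, ∀ z ∈ halfPlane C, gj j z = ((Λ.subgroup j).index : ℂ)⁻¹ *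
      ((P j).charpoly.roots.map fun μ => Complex.log (1 + μ / z)).sum := by
    intro j z hz
    refine HasSum.tsum_eq ?_
    refine ((hasSum_sum_log_one_add_div _ (hrP j)
      (hMC.trans (lt_norm_of_mem_halfPlane hz))).mul_left _).congr_fun fun n => ?_
    simp only [hc]
    rw [trace_pow_eq_sum_roots]
    ring
  have hf_eq : ∀ j, ∀ z ∈ halfPlane C, f j z = z ^ d * Complex.exp (gj j z) := by
    intro j z hz
    rw [(hf j).eqOn (hN j) (hstd j) (hdet j) hz, hgj_eq j z hz]
    rfl
  have hdet_eq : ∀ z ∈ halfPlane C, z ^ d * Complex.exp (g z) =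
      gammaDet Γ (a + algebraMap ℂ (L2 F →L[ℂ] L2 F) z) := fun z hz =>
    (gammaDet_eq (haC.trans hz) (summable_log_series hM hMC hcM' (hsub hz))).symm
  have hgj_cont : ∀ j, ContinuousOn (gj j) (halfPlane C) := fun j =>
    ((differentiableOn_sum_log_one_add_div _ (fun μ hμ => (hrP j μ hμ).trans hMC.le)
      hC0).const_mul _).continuousOn.congr (hgj_eq j)
  have hunif : TendstoUniformlyOn gj g atTop (halfPlane C) := hconv.mono hsub
  have hg_cont : ContinuousOn g (halfPlane C) :=
    hunif.continuousOn (Eventually.of_forall hgj_cont).frequently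
  have hexp : TendstoLocallyUniformlyOn (fun j => Complex.exp ∘ gj j) (Complex.exp ∘ g) atTop
      (halfPlane C) := by
    refine (tendstoLocallyUniformlyOn_iff_forall_isCompact (isOpen_halfPlane C)).2
      fun K hKsub hK => (hunif.mono hKsub).comp_cexp ?_
    exact hK.bddAbove_image (Complex.continuous_re.comp_continuousOn (hg_cont.mono hKsub))
  have hpow : TendstoLocallyUniformlyOn (fun (_ : ℕ) (z : ℂ) => z ^ d) (fun z => z ^ d) atTop
      (halfPlane C) := by
    refine TendstoUniformlyOn.tendstoLocallyUniformlyOn (Metric.tendstoUniformlyOn_iff.2 ?_)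
    intro ε hε
    simp [hε]
  have hmul := hpow.mul₀ hexp (continuous_pow d).continuousOn hg_cont.cexp
  exact (hmul.congr fun j z hz => (hf_eq j z hz).symm).congr_right fun z hz => hdet_eq z hz
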